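/- **Setting.** Let $1\le S\le K$ and let $\Phi=(\phi_1,\dots,\phi_K)$ be a unit norm frame of $\mathbb R^d$: $\|\phi_k\|_2=1$ and $A\|v\|_2^2\le\sum_k|\langle\phi_k,v\rangle|^2\le B\|v\|_2^2$ for all $v\in\mathbb R^d$, where $0<A\le B$. Its coherence is $\mu=\max_{j\ne k}|\langle\phi_j,\phi_k\rangle|$. The distance of two families of $K$ vectors is $d(\Psi,\Phi)=\max_k\min_\ell\|\psi_k\pm\phi_\ell\|_2$. Whenever $d(\Psi,\Phi)$ is used below, $\Psi$ is understood to be signed and arranged so that $d(\Psi,\Phi)=\max_k\|\psi_k-\phi_k\|_2$. **Signals.** Let $\nu$ be a sign and permutation invariant probability measure on the unit sphere of $\mathbb R^K$. For $x\in\mathbb R^K$ let $c_x(1)\ge\dots\ge c_x(K)\ge 0$ be the non-increasing rearrangement of $|x(1)|,\dots,|x(K)|$, put $c_x(K+1)=0$, and let $\nu_c$ be the law of $c_x$ when $x$ has law $\nu$. Assume that $\nu$ is $S$-sparse with absolute gap $\beta_S>0$ and relative gap $\Delta_S>\beta_S$, that is, $\nu$-almost surely $c_x(S)-c_x(S+1)\ge\beta_S$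 and $(c_x(S)-c_x(S+1))/c_x(1)\ge\Delta_S$. Assume that $\nu$ is exactly $S$-sparse, that is, $c_x(S+1)=0$ almost surely, and strongly $S$-sparse in the sense that $\Delta_S>2\mu S$. Put $\gamma_{1,S}=\mathbb E_c(c(1)+\dots+c(S))$. A (noiseless) training signal is $y=\Phi x_{c,p,\sigma}=\sum_k\sigma(k)\,c(p(k))\,\phi_k$, where $c\sim\nu_c$, the permutation $p$ and the sign sequence $\sigma$ are uniformly distributed, and $c,p,\sigma$ are independent. **Algorithm.** One iteration of ITKsM with input dictionary $\Psi$ and signals $y_1,\dots,y_N$ chooses, for every $n$, a set $I_n^t\in\arg\max_{|I|=S}\sum_{i\in I}|\langle\psi_i,y_n\rangle|$ (ties are broken by any fixed measurable rule), forms $\bar\psi_k=\frac1N\sum_{n:\,k\in I_n^t}\operatorname{sign}(\langle\psi_k,y_n\rangle)\,y_n$ for all $k$, and outputs $(\bar\psi_k/\|\bar\psi_k\|_2)_k$; an atom with $\bar\psi_k=0$ is set to $0$. **Claim.** Let $$R=\frac{\Delta_S-2\mu S}{\sqrt{98B}\left(\frac14+\sqrt{\log\left(\frac{1060K^2B}{(\Delta_S-2\mu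 S)\gamma_{1,S}}\right)}\right)}.$$ Fix a target error $0<\tilde\varepsilon\le R$. If the input dictionary $\Psi$ (with unit norm atoms) satisfies $d(\Psi,\Phi)\le R$, then after $6\lceil\log(\tilde\varepsilon^{-1})\rceil$ iterations of ITKsM, each on a fresh batch of $N$ training signals (all signals of all batches being independent), the output dictionary $\tilde\Psi$ satisfies $$d(\tilde\Psi,\Phi)\le\tilde\varepsilon,$$ except with probability at most $$18\,\log(\tilde\varepsilon^{-1})\,K\exp\left(\frac{-\gamma_{1,S}^2N\tilde\varepsilon^2}{200SK}\right).$$ -/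

import Mathlib

open MeasureTheory ProbabilityTheory
open scoped RealInnerProductSpace

noncomputable section

/-- Signals, and atoms, are vectors of `ℝ^d` with the Euclidean norm. -/
abbrev Vec (d : ℕ) := EuclideanSpace ℝ (Fin d)

/-- A family of `K` vectors of `ℝ^d` (the columns of a `d × K` matrix). -/
abbrev Atoms (d K : ℕ) := Fin K → Vec d

/-- A dictionary: all atoms have unit norm. -/
def IsDictionary {d K : ℕ} (Φ : Atoms d K) : Prop := ∀ k, ‖Φ k‖ = 1

/-- `Φ` is a frame of `ℝ^d` with frame constants `0 < A ≤ B`. -/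
def IsFrame {d K : ℕ} (Φ : Atoms d K) (A B : ℝ) : Prop :=
  0 < A ∧ A ≤ B ∧
    ∀ v : Vec d, A * ‖v‖ ^ 2 ≤ ∑ k, |⟪Φ k, v⟫| ^ 2 ∧ ∑ k, |⟪Φ k, v⟫| ^ 2 ≤ B * ‖v‖ ^ 2

/-- The coherence: the largest absolute inner product between two different atoms. -/
def coherence {d K : ℕ} (Φ : Atoms d K) : ℝ :=
  ⨆ q : {q : Fin K × Fin K // q.1 ≠ q.2}, |⟪Φ q.1.1, Φ q.1.2⟫|

/-- The (asymmetric) distance `d(Φ, Ψ) = max_k min_ℓ ‖φ_k ± ψ_ℓ‖`. -/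
def dictDist {d K : ℕ} (Φ Ψ : Atoms d K) : ℝ :=
  ⨆ k, ⨅ l, min ‖Φ k - Ψ l‖ ‖Φ k + Ψ l‖

/-- The two families are signed and arranged in such a way that their distance is attained by
corresponding atoms: `d(Φ, Ψ) = max_k ‖φ_k - ψ_k‖`. -/
def Aligned {d K : ℕ} (Φ Ψ : Atoms d K) : Prop := dictDist Φ Ψ = ⨆ k, ‖Φ k - Ψ k‖

/-! ### Coefficient distributions -/

instance permMeasurableSpace (K : ℕ) : MeasurableSpace (Equiv.Perm (Fin K)) := ⊤

instance permDiscrete (K : ℕ) : DiscreteMeasurableSpace (Equiv.Perm (Fin K)) := ⟨fun _ => trivial⟩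

instance signSingleton : MeasurableSingletonClass ℤˣ :=
  ⟨fun u => ⟨{(u : ℤ)}, measurableSet_singleton _, by ext v; simp [Units.ext_iff]⟩⟩

/-- A permutation that sorts the absolute values of the entries of `x` decreasingly. -/
def sortPerm {K : ℕ} (x : Vec K) : Equiv.Perm (Fin K) := Tuple.sort fun i => -|x i|

/-- The non-increasing rearrangement `c_x` of the absolute values of the entries of `x`. -/
def rearr {K : ℕ} (x : Vec K) : Fin K → ℝ := fun i => |x (sortPerm x i)|

theorem measurable_sortPerm {K : ℕ} : Measurable (sortPerm (K := K)) := by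
  refine measurable_to_countable' fun τ => ?_
  have h : sortPerm (K := K) ⁻¹' {τ} =
      {x : Vec K | ∀ i j : Fin K, i ≤ j → -|x (τ i)| ≤ -|x (τ j)|} ∩
      {x : Vec K | ∀ i j : Fin K, i < j → -|x (τ i)| = -|x (τ j)| → τ i < τ j} := by
    ext x
    simp only [Set.mem_preimage, Set.mem_singleton_iff, Set.mem_inter_iff, Set.mem_ofPred_eq]
    rw [eq_comm, sortPerm, Tuple.eq_sort_iff]
    rfl
  have hm : ∀ i : Fin K, Measurable fun x : Vec K => -|x i| := fun i => by fun_prop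
  rw [h]
  refine MeasurableSet.inter ?_ ?_
  · simp only [Set.ofPred_forall]
    exact .iInter fun i => .iInter fun j => .iInter fun _ => measurableSet_le (hm _) (hm _)
  · simp only [Set.ofPred_forall]
    refine .iInter fun i => .iInter fun j => .iInter fun _ => ?_
    by_cases hl : τ i < τ j
    · simp [hl]
    · simp only [hl, imp_false]
      exact (measurableSet_eq_fun (f := fun x : Vec K => -|x (τ i)|)
        (g := fun x : Vec K => -|x (τ j)|) (hm _) (hm _)).compl

/-- The rearrangement is measurable, so that its law under `ν` is a genuine push-forward. -/
theorem measurable_rearr {K : ℕ} : Measurable (rearr (K := K)) := by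
  refine measurable_pi_lambda _ fun i => ?_
  have h : Measurable fun q : Vec K × Equiv.Perm (Fin K) => |q.1 (q.2 i)| :=
    measurable_from_prod_countable_left fun τ => by
      change Measurable fun x : Vec K => |x (τ i)|
      fun_prop
  exact h.comp (measurable_id.prodMk measurable_sortPerm)

/-- The entry `c(k)` of a sequence of length `K`, counted from `1`, with `c(k) = 0` for `k > K`. -/
def entry {K : ℕ} (c : Fin K → ℝ) (k : ℕ) : ℝ :=
  if h : k - 1 < K then c ⟨k - 1, h⟩ else 0

/-- A probability measure on the unit sphere of `ℝ^K` which is invariant under changes of signs and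
under permutations of the coordinates. -/
structure IsCoeffDist {K : ℕ} (ν : Measure (Vec K)) : Prop where
  isProb : IsProbabilityMeasure ν
  sphere : ∀ᵐ x ∂ν, ‖x‖ = 1
  sign_inv : ∀ s : Fin K → ℤˣ,
    ν.map (fun x => WithLp.toLp 2 fun k => ((s k : ℤ) : ℝ) * x k) = ν
  perm_inv : ∀ p : Equiv.Perm (Fin K), ν.map (fun x => WithLp.toLp 2 fun k => x (p k)) = ν

/-- `ν` is `S`-sparse with absolute gap `β` and relative gap `Δ`. -/
structure IsSparse {K : ℕ} (ν : Measure (Vec K)) (S : ℕ) (β Δ : ℝ) : Prop where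
  abs_pos : 0 < β
  abs_lt_rel : β < Δ
  abs_gap : ν {x | entry (rearr x) S - entry (rearr x) (S + 1) < β} = 0
  rel_gap : ν {x | (entry (rearr x) S - entry (rearr x) (S + 1)) / entry (rearr x) 1 < Δ} = 0

/-- Exactly `S`-sparse coefficients: almost surely at most `S` entries do not vanish. -/
def IsExactlySparse {K : ℕ} (ν : Measure (Vec K)) (S : ℕ) : Prop :=
  ∀ᵐ x ∂ν, entry (rearr x) (S + 1) = 0

/-- The measure `ν_c` on non-increasing sequences which is induced by `ν`. -/
def rearrLaw {K : ℕ} (ν : Measure (Vec K)) : Measure (Fin K → ℝ) := ν.map rearr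

/-- `γ_{1,S} = 𝔼_c (c(1) + … + c(S))`. -/
def gammaOne {K : ℕ} (ν : Measure (Vec K)) (S : ℕ) : ℝ :=
  ∫ c, ∑ k ∈ Finset.Icc 1 S, entry c k ∂(rearrLaw ν)

/-! ### The noiseless signal model -/

/-- What is drawn for one signal: a sequence `c`, a permutation `p` and signs `σ`. -/
abbrev Draw (K : ℕ) := (Fin K → ℝ) × Equiv.Perm (Fin K) × (Fin K → ℤˣ)

/-- The law of a draw: `c` has the law `ν_c`, the permutation and the signs are uniformly
distributed, and the three are independent. -/
def drawLaw {K : ℕ} (ν : Measure (Vec K)) : Measure (Draw K) :=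
  (rearrLaw ν).prod ((uniformOn Set.univ).prod (uniformOn Set.univ))

/-- The signal `y = Φ x_{c,p,σ}` with `x_{c,p,σ}(k) = σ(k) c(p(k))`. -/
def signal {d K : ℕ} (Φ : Atoms d K) (w : Draw K) : Vec d :=
  ∑ k, (((w.2.2 k : ℤ) : ℝ) * w.1 (w.2.1 k)) • Φ k

/-! ### The algorithm -/

/-- A thresholding rule: a choice of `I^t = argmax_{|I| = S} ‖Ψ_I^⋆ y‖₁`. The maximiser need not be
unique; ties are broken in any way that is measurable in the dictionary and the signal. -/
structure ThresholdRule (d K S : ℕ) where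
  sel : Atoms d K → Vec d → Finset (Fin K)
  card_sel : ∀ Ψ y, (sel Ψ y).card = S
  sel_max : ∀ Ψ y (I : Finset (Fin K)), I.card = S →
    ∑ i ∈ I, |⟪Ψ i, y⟫| ≤ ∑ i ∈ sel Ψ y, |⟪Ψ i, y⟫|
  measurableSet_sel : ∀ I : Finset (Fin K),
    MeasurableSet {q : Atoms d K × Vec d | sel q.1 q.2 = I}

/-- The signal means `ψ̄_k = (1/N) ∑_n y_n sign⟪ψ_k, y_n⟫ χ(I^t_n, k)`. -/
def signalMean {d K S N : ℕ} (T : ThresholdRule d K S) (y : Fin N → Vec d) (Ψ : Atoms d K) :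
    Atoms d K := fun k =>
  (1 / (N : ℝ)) • ∑ n, (if k ∈ T.sel Ψ (y n) then Real.sign ⟪Ψ k, y n⟫ else 0) • y n

/-- One iteration of ITKsM on the batch `y`: the normalised signal means. (A mean which is zero, for
which the algorithm is not defined, is left as it is; it is at distance `1` from every unit
vector.) -/
def itksmStep {d K S N : ℕ} (T : ThresholdRule d K S) (y : Fin N → Vec d) (Ψ : Atoms d K) :
    Atoms d K := fun k => ‖signalMean T y Ψ k‖⁻¹ • signalMean T y Ψ k

/-- `L` iterations of ITKsM from the input dictionary `Ψ`, the `l`-th one on the batch `y l`. -/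
def itksm {d K S N L : ℕ} (T : ThresholdRule d K S) (y : Fin L → Fin N → Vec d) (Ψ : Atoms d K) :
    Atoms d K := Fin.foldl L (fun Ψ' l => itksmStep T (y l) Ψ') Ψ

/-- The convergence radius. -/
def convRadius (K S : ℕ) (B μ Δ γ : ℝ) : ℝ :=
  (Δ - 2 * μ * S) /
    (√(98 * B) * (1 / 4 + √(Real.log (1060 * (K : ℝ) ^ 2 * B / ((Δ - 2 * μ * S) * γ)))))

/-- The number of iterations, `6 ⌈log (1/ε)⌉`. -/
def numIter (ε : ℝ) : ℕ := 6 * ⌈Real.log ε⁻¹⌉₊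

end

/-! One iteration shrinks the largest atomwise error `e` to at most `3/5 * e` with high probability,
and `(3/5)^6 < 1/exp 1`; hence six iterations per unit of `log ε⁻¹` suffice.

For the contraction, the summand `signalTerm` is compared with `oracleTerm`, which uses the true
support and the true signs. The gap condition `2μS < Δ` makes the two equal unless some `⟪ψ_i - φ_i,
y⟫` is large (`signalTerm_eq_oracleTerm`). For fixed coefficients and permutation that inner product
is a Rademacher sum, so Hoeffding's inequality and the frame bound make the exception exponentially
rare in `1/e²` (`drawLaw_perturbationEvent_le`). The oracle mean is exactly `(γ/K) φ_k`
(`integral_oracleTerm`), and the convergence radius is such that the bias from the rare event is at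
most `eγ/(20K)` (`perturbation_bound_le`).

The empirical mean deviates from its expectation by at most `eγ/(4K)`, by a dimension free Bernstein
inequality (`measure_lt_norm_sum_le`) with second moment about `S/K`, which is where the exponent
gets its `SK`. The errors add up to `3/10 * e` relative to the length `γ/K`, and normalisation at
most doubles this.

The iterations are chained by induction (`measure_itksm_notMem_closeTo_le`): the current dictionary
is independent of the fresh batch, so the one-step bound applies conditionally. Radii are kept above
the target `ε`, so every step fails with probability at most the same quantity. Finally, low
coherence turns atomwise closeness into a statement about `dictDist` and `Aligned`. -/

/-! ### A vector Bernstein inequality in Hilbert space -/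

section Pinelis

variable {E : Type*} [NormedAddCommGroup E] [InnerProductSpace ℝ E]

/-- `u ↦ cosh √u` is convex. -/
theorem cosh_le_of_sq_eq {x y z θ : ℝ} (h0 : 0 ≤ θ) (h1 : θ ≤ 1)
    (h : x ^ 2 = θ * y ^ 2 + (1 - θ) * z ^ 2) :
    Real.cosh x ≤ θ * Real.cosh y + (1 - θ) * Real.cosh z := by
  refine hasSum_le (fun n => ?_) (Real.hasSum_cosh x)
    (((Real.hasSum_cosh y).mul_left θ).add ((Real.hasSum_cosh z).mul_left (1 - θ)))
  have hc := (convexOn_pow (𝕜 := ℝ) n).2 (Set.mem_Ici.2 (sq_nonneg y))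
    (Set.mem_Ici.2 (sq_nonneg z)) h0 (sub_nonneg.2 h1) (by ring)
  simp only [smul_eq_mul] at hc
  rw [← h] at hc
  simp only [pow_mul]
  calc (x ^ 2) ^ n / ((2 * n).factorial : ℝ)
      ≤ (θ * (y ^ 2) ^ n + (1 - θ) * (z ^ 2) ^ n) / ((2 * n).factorial : ℝ) := by gcongr
    _ = _ := by ring

theorem exp_le_one_add_add_sq {b : ℝ} (h0 : 0 ≤ b) (h1 : b ≤ 1) :
    Real.exp b ≤ 1 + b + b ^ 2 := by
  have := (abs_le.1 (Real.abs_exp_sub_one_sub_id_le (x := b) (by rwa [abs_of_nonneg h0]))).2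
  linarith

/-- The one-step estimate behind the Bernstein inequality. The term linear in `x` is isolated so
that it integrates to zero for a centred `x`; what is left multiplies `cosh ‖s‖` by `1 + ‖x‖²`,
independently of the dimension. -/
theorem cosh_norm_add_le (s x : E) (hx : ‖x‖ ≤ 1) :
    Real.cosh ‖s + x‖ ≤
      Real.cosh ‖s‖ * (1 + ‖x‖ ^ 2) + Real.sinh ‖s‖ / ‖s‖ * ⟪s, x⟫ := by
  have hb0 : 0 ≤ ‖x‖ := norm_nonneg x
  have hexp := exp_le_one_add_add_sq hb0 hx
  have hcs : Real.cosh ‖x‖ + Real.sinh ‖x‖ = Real.exp ‖x‖ := Real.cosh_add_sinh _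
  rcases eq_or_ne s 0 with rfl | hs
  · have h2 : Real.cosh ‖x‖ ≤ 1 + ‖x‖ ^ 2 := by
      have := Real.self_le_sinh_iff.2 hb0
      linarith
    simpa using h2
  rcases eq_or_ne x 0 with rfl | hx0
  · simp
  have ha : 0 < ‖s‖ := norm_pos_iff.2 hs
  have hb : 0 < ‖x‖ := norm_pos_iff.2 hx0
  set a := ‖s‖
  set b := ‖x‖
  have hr := abs_le.1 (abs_real_inner_le_norm s x)
  set r := ⟪s, x⟫ with hrdef
  have hab : 0 < a * b := mul_pos ha hb
  have hq1 : r / (a * b) ≤ 1 := (div_le_one hab).2 hr.2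
  have hq2 : -1 ≤ r / (a * b) := by rw [le_div_iff₀ hab]; linarith [hr.1]
  -- The quotient `r / (a * b)` is the cosine of the angle between `s` and `x`, so the squared norm
  -- interpolates between the parallel and the antiparallel case, and the convexity lemma applies.
  have hn : ‖s + x‖ ^ 2 = (1 + r / (a * b)) / 2 * (a + b) ^ 2 +
      (1 - (1 + r / (a * b)) / 2) * (a - b) ^ 2 := by
    rw [norm_add_sq_real]
    field_simp
    ring
  have hc := cosh_le_of_sq_eq (by linarith) (by linarith) hn
  rw [Real.cosh_add, Real.cosh_sub] at hc
  have hsb : b ≤ Real.sinh b := Real.self_le_sinh_iff.2 hb0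
  have hsa : 0 ≤ Real.sinh a := Real.sinh_nonneg_iff.2 ha.le
  have hsc : Real.sinh a ≤ Real.cosh a := (Real.sinh_lt_cosh a).le
  calc Real.cosh ‖s + x‖ ≤ Real.cosh a * Real.cosh b +
        r / (a * b) * (Real.sinh a * Real.sinh b) := by linarith
    _ = Real.cosh a * Real.cosh b + r / (a * b) * (Real.sinh a * (Real.sinh b - b)) +
        Real.sinh a / a * r := by field_simp; ring
    _ ≤ Real.cosh a * Real.cosh b + 1 * (Real.cosh a * (Real.sinh b - b)) +
        Real.sinh a / a * r := by
        have hsb' : 0 ≤ Real.sinh b - b := sub_nonneg.2 hsb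
        gcongr
    _ = Real.cosh a * (Real.exp b - b) + Real.sinh a / a * r := by rw [← hcs]; ring
    _ ≤ _ := by
        have := Real.cosh_pos a
        gcongr
        linarith

variable [MeasurableSpace E] [BorelSpace E] [SecondCountableTopology E] [CompleteSpace E]
  {Ω : Type*} [MeasurableSpace Ω] {P : Measure Ω} [IsProbabilityMeasure P]

theorem lintegral_cosh_norm_add_le {ρ : Measure E} [IsProbabilityMeasure ρ] {v : ℝ}
    (hb : ∀ᵐ x ∂ρ, ‖x‖ ≤ 1) (hm : ∫ x, x ∂ρ = 0) (hv : ∫ x, ‖x‖ ^ 2 ∂ρ ≤ v) (s : E) :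
    ∫⁻ x, ENNReal.ofReal (Real.cosh ‖s + x‖) ∂ρ ≤
      ENNReal.ofReal (Real.cosh ‖s‖ * (1 + v)) := by
  have hi1 : Integrable (fun x : E => x) ρ :=
    Integrable.of_bound (by fun_prop) 1 hb
  have hi2 : Integrable (fun x : E => ‖x‖ ^ 2) ρ := by
    refine Integrable.of_bound (by fun_prop) 1 ?_
    filter_upwards [hb] with x hx
    rw [Real.norm_of_nonneg (by positivity)]
    exact pow_le_one₀ (norm_nonneg _) hx
  have hi3 : Integrable (fun x : E => ⟪s, x⟫) ρ := hi1.const_inner s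
  have hi5 : Integrable (fun x : E => 1 + ‖x‖ ^ 2) ρ := (integrable_const _).add hi2
  have hi4 : Integrable (fun x => Real.cosh ‖s‖ * (1 + ‖x‖ ^ 2) +
      Real.sinh ‖s‖ / ‖s‖ * ⟪s, x⟫) ρ :=
    (hi5.const_mul _).add (hi3.const_mul _)
  calc ∫⁻ x, ENNReal.ofReal (Real.cosh ‖s + x‖) ∂ρ
      ≤ ∫⁻ x, ENNReal.ofReal (Real.cosh ‖s‖ * (1 + ‖x‖ ^ 2) +
          Real.sinh ‖s‖ / ‖s‖ * ⟪s, x⟫) ∂ρ := by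
        refine lintegral_mono_ae ?_
        filter_upwards [hb] with x hx
        exact ENNReal.ofReal_le_ofReal (cosh_norm_add_le s x hx)
    _ = ENNReal.ofReal (∫ x, (Real.cosh ‖s‖ * (1 + ‖x‖ ^ 2) +
          Real.sinh ‖s‖ / ‖s‖ * ⟪s, x⟫) ∂ρ) := by
        rw [ofReal_integral_eq_lintegral_ofReal hi4]
        filter_upwards [hb] with x hx
        exact (Real.cosh_pos _).le.trans (cosh_norm_add_le s x hx)
    _ ≤ _ := by
        refine ENNReal.ofReal_le_ofReal ?_
        rw [integral_add (hi5.const_mul _) (hi3.const_mul _),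
          integral_const_mul, integral_const_mul, integral_add (integrable_const _) hi2,
          integral_inner hi1, hm]
        simp only [integral_const, probReal_univ, smul_eq_mul, inner_zero_right, mul_zero,
          add_zero, mul_one]
        have := Real.cosh_pos ‖s‖
        gcongr

/-- By independence and Tonelli the last summand can be integrated with the partial sum frozen,
which costs a factor `1 + v`. Lower integrals are used so that no integrability has to be carried
through the induction. -/
theorem lintegral_cosh_norm_sum_le {ι : Type*} {X : ι → Ω → E} {v : ℝ}
    (hX : ∀ i, Measurable (X i)) (hind : iIndepFun X P) (hb : ∀ i, ∀ᵐ ω ∂P, ‖X i ω‖ ≤ 1)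
    (hm : ∀ i, ∫ ω, X i ω ∂P = 0) (hv : ∀ i, ∫ ω, ‖X i ω‖ ^ 2 ∂P ≤ v) (hv0 : 0 ≤ v)
    (t : Finset ι) :
    ∫⁻ ω, ENNReal.ofReal (Real.cosh ‖∑ i ∈ t, X i ω‖) ∂P ≤
      ENNReal.ofReal ((1 + v) ^ t.card) := by
  classical
  induction t using Finset.induction_on with
  | empty => simp
  | insert i t hi ih =>
    have hI : IndepFun (fun ω => ∑ j ∈ t, X j ω) (X i) P := by
      have h := hind.indepFun_finsetSum_of_notMem hX hi
      convert h using 1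
      ext ω
      simp
    have hS : Measurable fun ω => ∑ j ∈ t, X j ω := by fun_prop
    have hprod := (indepFun_iff_map_prod_eq_prod_map_map hS.aemeasurable
      (hX i).aemeasurable).1 hI
    have hP1 : IsProbabilityMeasure (P.map (X i)) :=
      Measure.isProbabilityMeasure_map (hX i).aemeasurable
    have hP2 : IsProbabilityMeasure (P.map fun ω => ∑ j ∈ t, X j ω) :=
      Measure.isProbabilityMeasure_map hS.aemeasurable
    have hf : Measurable fun q : E × E => ENNReal.ofReal (Real.cosh ‖q.1 + q.2‖) := by
      fun_prop
    have hstep : ∀ s : E, ∫⁻ x, ENNReal.ofReal (Real.cosh ‖s + x‖) ∂(P.map (X i)) ≤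
        ENNReal.ofReal (Real.cosh ‖s‖ * (1 + v)) := by
      refine fun s => lintegral_cosh_norm_add_le ?_ ?_ ?_ s
      · exact (ae_map_iff (hX i).aemeasurable
          (measurableSet_le measurable_norm measurable_const)).2 (hb i)
      · rw [integral_map (hX i).aemeasurable (by fun_prop)]
        exact hm i
      · rw [integral_map (hX i).aemeasurable (by fun_prop)]
        exact hv i
    calc ∫⁻ ω, ENNReal.ofReal (Real.cosh ‖∑ j ∈ insert i t, X j ω‖) ∂P
        = ∫⁻ ω, ENNReal.ofReal (Real.cosh ‖∑ j ∈ t, X j ω + X i ω‖) ∂P := by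
          simp only [Finset.sum_insert hi, add_comm]
      _ = ∫⁻ q, ENNReal.ofReal (Real.cosh ‖q.1 + q.2‖)
            ∂(P.map fun ω => (∑ j ∈ t, X j ω, X i ω)) :=
          (lintegral_map hf (hS.prodMk (hX i))).symm
      _ = ∫⁻ s, ∫⁻ x, ENNReal.ofReal (Real.cosh ‖s + x‖) ∂(P.map (X i))
            ∂(P.map fun ω => ∑ j ∈ t, X j ω) := by
          rw [hprod, lintegral_prod _ hf.aemeasurable]
      _ ≤ ∫⁻ s, ENNReal.ofReal (Real.cosh ‖s‖ * (1 + v))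
            ∂(P.map fun ω => ∑ j ∈ t, X j ω) := lintegral_mono hstep
      _ = ∫⁻ ω, ENNReal.ofReal (Real.cosh ‖∑ j ∈ t, X j ω‖) * ENNReal.ofReal (1 + v) ∂P := by
          rw [lintegral_map (by fun_prop) hS]
          simp only [ENNReal.ofReal_mul (Real.cosh_pos _).le]
      _ ≤ ENNReal.ofReal ((1 + v) ^ t.card) * ENNReal.ofReal (1 + v) := by
          rw [lintegral_mul_const _ (by fun_prop)]
          gcongr
      _ = _ := by
          rw [← ENNReal.ofReal_mul (by positivity), Finset.card_insert_of_notMem hi, pow_succ]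

/-- A dimension free Bernstein inequality, in the range of moderate deviations. -/
theorem measure_lt_norm_sum_le {N : ℕ} {X : Fin N → Ω → E} {v M t : ℝ}
    (hX : ∀ i, Measurable (X i)) (hind : iIndepFun X P) (hb : ∀ i, ∀ᵐ ω ∂P, ‖X i ω‖ ≤ M)
    (hm : ∀ i, ∫ ω, X i ω ∂P = 0) (hv : ∀ i, ∫ ω, ‖X i ω‖ ^ 2 ∂P ≤ v) (hv0 : 0 < v)
    (ht : 0 < t) (htM : t * M ≤ 2 * v) :
    P {ω | N * t < ‖∑ i, X i ω‖} ≤ ENNReal.ofReal (2 * Real.exp (-(N * t ^ 2 / (4 * v)))) := by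
  -- This minimises the exponent `N(l²v - lt)`; the assumption `htM` says exactly that the rescaled
  -- variables then have norm at most `1` (`l * M ≤ 1`).
  set l : ℝ := t / (2 * v) with hl
  have hl0 : 0 < l := by positivity
  have hY := lintegral_cosh_norm_sum_le (X := fun i ω => l • X i ω) (v := l ^ 2 * v) (P := P)
    (fun i => (hX i).const_smul l)
    (hind.comp (fun _ x => l • x) fun _ => measurable_const_smul l) ?_ ?_ ?_ (by positivity)
    Finset.univ
  · simp only [← Finset.smul_sum, norm_smul, Real.norm_of_nonneg hl0.le, Finset.card_univ,
      Fintype.card_fin] at hY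
    have hmk := mul_meas_ge_le_lintegral₀ (μ := P)
      (f := fun ω => ENNReal.ofReal (Real.cosh (l * ‖∑ i, X i ω‖))) (by fun_prop)
      (ENNReal.ofReal (Real.exp (l * (N * t)) / 2))
    have hsub : {ω | N * t < ‖∑ i, X i ω‖} ⊆ {ω | ENNReal.ofReal (Real.exp (l * (N * t)) / 2) ≤
        ENNReal.ofReal (Real.cosh (l * ‖∑ i, X i ω‖))} := by
      intro ω hω
      refine ENNReal.ofReal_le_ofReal ?_
      rw [Real.cosh_eq]
      have h1 : Real.exp (l * (N * t)) ≤ Real.exp (l * ‖∑ i, X i ω‖) := by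
        have : N * t < ‖∑ i, X i ω‖ := hω
        gcongr
      have := Real.exp_pos (-(l * ‖∑ i, X i ω‖))
      linarith
    have hpow : (1 + l ^ 2 * v) ^ N ≤ Real.exp (N * (l ^ 2 * v)) := by
      rw [Real.exp_nat_mul]
      gcongr
      linarith [Real.add_one_le_exp (l ^ 2 * v)]
    have hpos : 0 < Real.exp (l * (N * t)) / 2 := by positivity
    have hfin : ENNReal.ofReal (Real.exp (l * (N * t)) / 2) * P {ω | N * t < ‖∑ i, X i ω‖} ≤
        ENNReal.ofReal (Real.exp (N * (l ^ 2 * v))) :=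
      (mul_le_mul_right (measure_mono hsub) _).trans
        (hmk.trans (hY.trans (ENNReal.ofReal_le_ofReal hpow)))
    rw [mul_comm, ← ENNReal.le_div_iff_mul_le (Or.inl (by simpa using hpos))
      (Or.inl ENNReal.ofReal_ne_top), ← ENNReal.ofReal_div_of_pos hpos] at hfin
    refine hfin.trans (ENNReal.ofReal_le_ofReal (le_of_eq ?_))
    rw [div_div_eq_mul_div, mul_comm, mul_div_assoc, ← Real.exp_sub]
    congr 2
    rw [hl]
    field_simp
    ring
  · intro i
    filter_upwards [hb i] with ω hω
    rw [norm_smul, Real.norm_of_nonneg hl0.le]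
    calc l * ‖X i ω‖ ≤ l * M := by gcongr
      _ ≤ 1 := by rw [hl, div_mul_eq_mul_div, div_le_one (by positivity)]; exact htM
  · intro i
    rw [integral_smul, hm i, smul_zero]
  · intro i
    simp only [norm_smul, mul_pow, Real.norm_of_nonneg hl0.le]
    rw [integral_const_mul]
    have := hv i
    gcongr

end Pinelis

/-! ### Averages over signs and permutations -/

theorem integral_uniformOn_univ {α F : Type*} [Fintype α] [Nonempty α] [MeasurableSpace α]
    [MeasurableSingletonClass α] [NormedAddCommGroup F] [NormedSpace ℝ F] [CompleteSpace F]
    (f : α → F) :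
    ∫ x, f x ∂(uniformOn (Set.univ : Set α)) = (Fintype.card α : ℝ)⁻¹ • ∑ x, f x := by
  rw [integral_fintype .of_finite, Finset.smul_sum]
  refine Finset.sum_congr rfl fun x _ => ?_
  congr 1
  simp [Measure.real, uniformOn_univ]

section Signs

variable {K : ℕ}

theorem sum_sign_mul_sign (j k : Fin K) :
    ∑ σ : Fin K → ℤˣ, ((σ j : ℤ) : ℝ) * ((σ k : ℤ) : ℝ) =
      if j = k then (Fintype.card (Fin K → ℤˣ) : ℝ) else 0 := by
  split_ifs with h
  · subst h
    have (u : ℤˣ) : ((u : ℤ) : ℝ) * ((u : ℤ) : ℝ) = 1 := by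
      rcases Int.units_eq_one_or u with rfl | rfl <;> simp
    simp only [this]
    simp
  -- Flipping the sign at `j` is a bijection of the sign vectors that negates every summand, so the
  -- sum vanishes.
  · have h1 := Equiv.sum_comp (Equiv.mulLeft (Pi.mulSingle j (-1) : Fin K → ℤˣ))
      fun σ : Fin K → ℤˣ => ((σ j : ℤ) : ℝ) * ((σ k : ℤ) : ℝ)
    have h2 : ∀ σ : Fin K → ℤˣ,
        (((Equiv.mulLeft (Pi.mulSingle j (-1) : Fin K → ℤˣ) σ) j : ℤ) : ℝ) *
          (((Equiv.mulLeft (Pi.mulSingle j (-1) : Fin K → ℤˣ) σ) k : ℤ) : ℝ) =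
        -(((σ j : ℤ) : ℝ) * ((σ k : ℤ) : ℝ)) := by
      intro σ
      simp [Pi.mulSingle_eq_of_ne (Ne.symm h)]
    simp only [h2, Finset.sum_neg_distrib] at h1
    linarith

variable {E : Type*} [NormedAddCommGroup E] [InnerProductSpace ℝ E]

theorem integral_sign_smul_sum [CompleteSpace E] (k : Fin K) (v : Fin K → E) :
    ∫ σ : Fin K → ℤˣ, ((σ k : ℤ) : ℝ) • ∑ j, ((σ j : ℤ) : ℝ) • v j ∂(uniformOn Set.univ) =
      v k := by
  rw [integral_uniformOn_univ]
  have h : ∀ σ : Fin K → ℤˣ, ((σ k : ℤ) : ℝ) • ∑ j, ((σ j : ℤ) : ℝ) • v j =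
      ∑ j, (((σ k : ℤ) : ℝ) * ((σ j : ℤ) : ℝ)) • v j := by
    intro σ
    simp only [Finset.smul_sum, smul_smul]
  simp only [h]
  rw [Finset.sum_comm]
  simp only [← Finset.sum_smul, sum_sign_mul_sign, ite_smul, zero_smul]
  rw [Finset.sum_ite_eq, if_pos (Finset.mem_univ _), smul_smul, inv_mul_cancel₀, one_smul]
  simp

theorem integral_norm_sum_sign_sq (v : Fin K → E) :
    ∫ σ : Fin K → ℤˣ, ‖∑ j, ((σ j : ℤ) : ℝ) • v j‖ ^ 2 ∂(uniformOn Set.univ) =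
      ∑ j, ‖v j‖ ^ 2 := by
  rw [integral_uniformOn_univ]
  simp only [← real_inner_self_eq_norm_sq, sum_inner, inner_sum, real_inner_smul_left,
    real_inner_smul_right, ← mul_assoc]
  rw [Finset.sum_comm]
  conv_lhs => enter [2, 2, j]; rw [Finset.sum_comm]
  simp only [← Finset.sum_mul, sum_sign_mul_sign, ite_mul, zero_mul]
  simp only [Finset.sum_ite_eq, Finset.mem_univ, if_true, smul_eq_mul]
  rw [← Finset.mul_sum, ← mul_assoc, inv_mul_cancel₀ (by simp), one_mul]

/-- The sum over all sign vectors factorises into hyperbolic cosines, each bounded through `cosh x ≤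
exp (x² / 2)`. -/
theorem mgf_sum_sign_le (a : Fin K → ℝ) (l : ℝ) :
    mgf (fun σ : Fin K → ℤˣ => ∑ j, ((σ j : ℤ) : ℝ) * a j) (uniformOn Set.univ) l ≤
      Real.exp (l ^ 2 * (∑ j, a j ^ 2) / 2) := by
  rw [mgf, integral_uniformOn_univ]
  have h1 : ∑ σ : Fin K → ℤˣ, Real.exp (l * ∑ j, ((σ j : ℤ) : ℝ) * a j) =
      ∏ j, ∑ u : ℤˣ, Real.exp (l * (((u : ℤ) : ℝ) * a j)) := by
    rw [Finset.prod_univ_sum, Fintype.piFinset_univ]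
    simp only [Finset.mul_sum, Real.exp_sum]
  have h2 : ∀ j, ∑ u : ℤˣ, Real.exp (l * (((u : ℤ) : ℝ) * a j)) = 2 * Real.cosh (l * a j) := by
    intro j
    rw [UnitsInt.univ, Finset.sum_pair (by decide), Real.cosh_eq]
    simp
    ring
  rw [h1]
  simp only [h2, Finset.prod_mul_distrib]
  have h3 : (Fintype.card (Fin K → ℤˣ) : ℝ) = 2 ^ K := by simp
  simp only [h3, Finset.prod_const, Finset.card_univ, Fintype.card_fin, smul_eq_mul]
  rw [← mul_assoc, inv_mul_cancel₀ (by positivity), one_mul, Finset.mul_sum, Finset.sum_div,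
    Real.exp_sum]
  refine Finset.prod_le_prod (fun j _ => (Real.cosh_pos _).le) fun j _ => ?_
  rw [← mul_pow]
  exact Real.cosh_le_exp_half_sq _

/-- Hoeffding's inequality for a Rademacher sum. -/
theorem measureReal_le_abs_sum_sign_le (a : Fin K → ℝ) {t V : ℝ} (ht : 0 ≤ t) (hV : 0 < V)
    (h : ∑ j, a j ^ 2 ≤ V) :
    (uniformOn (Set.univ : Set (Fin K → ℤˣ))).real {σ | t ≤ |∑ j, ((σ j : ℤ) : ℝ) * a j|} ≤
      2 * Real.exp (-(t ^ 2 / (2 * V))) := by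
  have key : ∀ b : Fin K → ℝ, ∑ j, b j ^ 2 ≤ V →
      (uniformOn (Set.univ : Set (Fin K → ℤˣ))).real {σ | t ≤ ∑ j, ((σ j : ℤ) : ℝ) * b j} ≤
        Real.exp (-(t ^ 2 / (2 * V))) := by
    intro b hb
    refine (measure_ge_le_exp_mul_mgf t (t := t / V) (by positivity) .of_finite).trans ?_
    calc Real.exp (-(t / V) * t) * mgf _ _ (t / V)
        ≤ Real.exp (-(t / V) * t) * Real.exp ((t / V) ^ 2 * (∑ j, b j ^ 2) / 2) := by
          gcongr
          exact mgf_sum_sign_le b _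
      _ ≤ Real.exp (-(t / V) * t) * Real.exp ((t / V) ^ 2 * V / 2) := by gcongr
      _ = _ := by
          rw [← Real.exp_add]
          congr 1
          field_simp
          ring
  have h1 := key a h
  have h2 := key (fun j => -a j) (by simpa using h)
  have hsub : {σ : Fin K → ℤˣ | t ≤ |∑ j, ((σ j : ℤ) : ℝ) * a j|} ⊆
      {σ | t ≤ ∑ j, ((σ j : ℤ) : ℝ) * a j} ∪ {σ | t ≤ ∑ j, ((σ j : ℤ) : ℝ) * -a j} := by
    intro σ hσ
    simpa [le_abs] using hσ
  have := (measureReal_mono (μ := uniformOn Set.univ) hsub).trans (measureReal_union_le _ _)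
  linarith

theorem integral_perm_apply (f : Fin K → ℝ) (k : Fin K) :
    ∫ p : Equiv.Perm (Fin K), f (p k) ∂(uniformOn Set.univ) = (∑ i, f i) / K := by
  have hK : (K : ℝ) ≠ 0 := by
    have := k.pos
    positivity
  rw [integral_uniformOn_univ]
  -- Composition with a transposition shows that the sum does not depend on the position; summing
  -- over all positions then evaluates it.
  have h1 : ∀ l, ∑ p : Equiv.Perm (Fin K), f (p l) = ∑ p : Equiv.Perm (Fin K), f (p k) := by
    intro l
    rw [← Equiv.sum_comp (Equiv.mulRight (Equiv.swap k l))]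
    simp
  have h2 : (K : ℝ) * ∑ p : Equiv.Perm (Fin K), f (p k) =
      Fintype.card (Equiv.Perm (Fin K)) * ∑ i, f i := by
    calc (K : ℝ) * ∑ p : Equiv.Perm (Fin K), f (p k)
        = ∑ l, ∑ p : Equiv.Perm (Fin K), f (p l) := by simp [h1]
      _ = ∑ p : Equiv.Perm (Fin K), ∑ l, f (p l) := Finset.sum_comm
      _ = _ := by simp [Equiv.sum_comp]
  have hc : (Fintype.card (Equiv.Perm (Fin K)) : ℝ) ≠ 0 := by
    exact_mod_cast Fintype.card_ne_zero
  rw [smul_eq_mul]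
  field_simp
  linarith

end Signs

/-! ### Sorted coefficient sequences -/

section Coefficients

variable {K : ℕ}

/-- The properties shared by almost all sequences drawn from `ν_c`. -/
structure IsSparseSeq (S : ℕ) (Δ : ℝ) (c : Fin K → ℝ) : Prop where
  nonneg : ∀ i, 0 ≤ c i
  le_first : ∀ i, c i ≤ entry c 1
  sum_sq : ∑ i, c i ^ 2 = 1
  eq_zero : ∀ i, S ≤ i.val → c i = 0
  gap : ∀ i, i.val < S → Δ * entry c 1 ≤ c i

theorem entry_of_lt (c : Fin K → ℝ) (i : Fin K) : entry c (i.val + 1) = c i := by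
  simp [entry]

theorem entry_one (hK : 0 < K) (c : Fin K → ℝ) : entry c 1 = c ⟨0, hK⟩ :=
  entry_of_lt c ⟨0, hK⟩

theorem measurable_entry (k : ℕ) : Measurable fun c : Fin K → ℝ => entry c k := by
  by_cases h : k - 1 < K
  · simp only [entry, h, dif_pos]
    fun_prop
  · simp only [entry, h, dif_neg, not_false_eq_true]
    fun_prop

theorem measurableSet_isSparseSeq (S : ℕ) (Δ : ℝ) :
    MeasurableSet {c : Fin K → ℝ | IsSparseSeq S Δ c} := by
  have h : {c : Fin K → ℝ | IsSparseSeq S Δ c} =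
      (⋂ i, {c | 0 ≤ c i}) ∩ (⋂ i, {c | c i ≤ entry c 1}) ∩ {c | ∑ i, c i ^ 2 = 1} ∩
      (⋂ i, ⋂ _ : S ≤ i.val, {c | c i = 0}) ∩
      (⋂ i, ⋂ _ : i.val < S, {c | Δ * entry c 1 ≤ c i}) := by
    ext c
    simp only [Set.mem_inter_iff, Set.mem_iInter]
    exact ⟨fun h => ⟨⟨⟨⟨h.1, h.2⟩, h.3⟩, h.4⟩, h.5⟩,
      fun h => ⟨h.1.1.1.1, h.1.1.1.2, h.1.1.2, h.1.2, h.2⟩⟩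
  have he := measurable_entry (K := K) 1
  have hc : ∀ i : Fin K, Measurable fun c : Fin K → ℝ => c i := measurable_pi_apply
  rw [h]
  refine ((((MeasurableSet.iInter fun i => measurableSet_le measurable_const (hc i)).inter
    (.iInter fun i => measurableSet_le (hc i) he)).inter
    (measurableSet_eq_fun (by fun_prop) measurable_const)).inter
    (.iInter fun i => .iInter fun _ => measurableSet_eq_fun (hc i) measurable_const)).inter
    (.iInter fun i => .iInter fun _ => measurableSet_le (he.const_mul _) (hc i))

theorem rearr_antitone (x : Vec K) : Antitone (rearr x) := by
  intro i j hij
  have h := Tuple.monotone_sort (fun i => -|x i|) hij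
  simp only [Function.comp_apply, neg_le_neg_iff] at h
  exact h

theorem isSparseSeq_rearr {S : ℕ} {Δ : ℝ} (hS : 1 ≤ S) (hSK : S ≤ K) {x : Vec K}
    (h1 : ‖x‖ = 1) (h0 : entry (rearr x) (S + 1) = 0)
    (hg : Δ ≤ (entry (rearr x) S - entry (rearr x) (S + 1)) / entry (rearr x) 1) :
    IsSparseSeq S Δ (rearr x) := by
  have hK : 0 < K := hS.trans hSK
  have hnn : ∀ i, 0 ≤ rearr x i := fun i => abs_nonneg _
  have hle : ∀ i, rearr x i ≤ entry (rearr x) 1 := by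
    intro i
    rw [entry_one hK]
    exact rearr_antitone x (Fin.mk_le_of_le_val (Nat.zero_le _))
  have hsq : ∑ i, rearr x i ^ 2 = 1 := by
    simp only [rearr, sq_abs]
    rw [Equiv.sum_comp (sortPerm x) fun i => x i ^ 2, ← EuclideanSpace.real_norm_sq_eq, h1]
    norm_num
  -- The relative gap divides by this entry; the unit norm excludes the value zero.
  have hpos : 0 < entry (rearr x) 1 := by
    by_contra hneg
    have hz : ∀ i, rearr x i = 0 := fun i =>
      le_antisymm ((hle i).trans (not_lt.1 hneg)) (hnn i)
    simp [hz] at hsq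
  refine ⟨hnn, hle, hsq, fun i hi => ?_, fun i hi => ?_⟩
  · refine le_antisymm ?_ (hnn i)
    -- An index `i ≥ S` exists only if `S < K`, so `entry (rearr x) (S + 1)` is here a genuine
    -- coefficient and not the default `0`.
    have hSK' : S < K := lt_of_le_of_lt hi i.2
    rw [← h0, entry_of_lt (rearr x) ⟨S, hSK'⟩]
    exact rearr_antitone x hi
  · rw [h0, sub_zero, le_div_iff₀ hpos] at hg
    refine hg.trans ?_
    have hS' : S - 1 < K := by omega
    have he : entry (rearr x) S = rearr x ⟨S - 1, hS'⟩ := by simp [entry, hS']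
    rw [he]
    exact rearr_antitone x (Fin.le_def.2 (by simp; omega))

theorem ae_isSparseSeq {S : ℕ} {β Δ : ℝ} (hS : 1 ≤ S) (hSK : S ≤ K) {ν : Measure (Vec K)}
    (hν : IsCoeffDist ν) (hgap : IsSparse ν S β Δ) (hexact : IsExactlySparse ν S) :
    ∀ᵐ c ∂(rearrLaw ν), IsSparseSeq S Δ c := by
  refine (ae_map_iff measurable_rearr.aemeasurable (measurableSet_isSparseSeq S Δ)).2 ?_
  have hg : ∀ᵐ x ∂ν, Δ ≤ (entry (rearr x) S - entry (rearr x) (S + 1)) / entry (rearr x) 1 := by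
    rw [ae_iff]
    simpa only [not_le] using hgap.rel_gap
  filter_upwards [hν.sphere, hexact, hg] with x h1 h2 h3
  exact isSparseSeq_rearr hS hSK h1 h2 h3

theorem isProbabilityMeasure_rearrLaw {ν : Measure (Vec K)} (hν : IsCoeffDist ν) :
    IsProbabilityMeasure (rearrLaw ν) :=
  have := hν.isProb
  Measure.isProbabilityMeasure_map measurable_rearr.aemeasurable

theorem sum_entry_eq {S : ℕ} (hSK : S ≤ K) (c : Fin K → ℝ) :
    ∑ k ∈ Finset.Icc 1 S, entry c k = ∑ i : Fin K, if i.val < S then c i else 0 := by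
  have h1 : ∀ i : Fin K, (if i.val < S then c i else 0) =
      (fun n : ℕ => if n < S then entry c (n + 1) else 0) i.val := fun i => by
    simp only [entry_of_lt]
  simp only [h1]
  rw [Fin.sum_univ_eq_sum_range (fun n : ℕ => if n < S then entry c (n + 1) else 0) K,
    ← Finset.sum_filter]
  have h2 : (Finset.range K).filter (· < S) = Finset.range S := by
    ext n
    simp only [Finset.mem_filter, Finset.mem_range]
    omega
  rw [h2, ← Finset.Ico_add_one_right_eq_Icc, Finset.sum_Ico_eq_sum_range]
  simp [add_comm]

variable {S : ℕ} {Δ : ℝ} {c : Fin K → ℝ}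

theorem IsSparseSeq.first_pos (h : IsSparseSeq S Δ c) : 0 < entry c 1 := by
  by_contra hneg
  have hz : ∀ i, c i = 0 := fun i => le_antisymm ((h.le_first i).trans (not_lt.1 hneg)) (h.nonneg i)
  simpa [hz] using h.sum_sq

theorem IsSparseSeq.le_one (h : IsSparseSeq S Δ c) (i : Fin K) : c i ≤ 1 := by
  have h1 : c i ^ 2 ≤ 1 := by
    rw [← h.sum_sq]
    exact Finset.single_le_sum (fun j _ => sq_nonneg (c j)) (Finset.mem_univ i)
  nlinarith [h.nonneg i]

theorem IsSparseSeq.gap_le_one (hS : 1 ≤ S) (hSK : S ≤ K) (h : IsSparseSeq S Δ c) : Δ ≤ 1 := by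
  have hK : 0 < K := hS.trans hSK
  have h1 := h.gap ⟨0, hK⟩ hS
  rw [← entry_one hK c] at h1
  have := h.first_pos
  nlinarith

theorem card_filter_val_lt (hSK : S ≤ K) :
    (Finset.univ.filter fun i : Fin K => i.val < S).card = S := by
  rw [Fin.card_filter_val_lt]
  omega

theorem IsSparseSeq.sum_le (hSK : S ≤ K) (h : IsSparseSeq S Δ c) : ∑ i, c i ≤ S * entry c 1 := by
  calc ∑ i, c i = ∑ i, if i.val < S then c i else 0 := by
        refine Finset.sum_congr rfl fun i _ => ?_
        split_ifs with hi
        · rfl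
        · exact h.eq_zero i (not_lt.1 hi)
    _ ≤ ∑ i : Fin K, if i.val < S then entry c 1 else 0 := by
        gcongr with i
        split_ifs
        · exact h.le_first i
        · exact le_rfl
    _ = _ := by
        rw [← Finset.sum_filter, Finset.sum_const, card_filter_val_lt hSK, nsmul_eq_mul]

/-- Since `0 ≤ c i ≤ 1`, the sum dominates `∑ c i ^ 2 = 1`, and it has only `S` nonzero terms.
Integration gives `1 ≤ γ ≤ S`, which the radius estimates need. -/
theorem IsSparseSeq.sum_ite_mem_Icc (hSK : S ≤ K) (h : IsSparseSeq S Δ c) :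
    (∑ i : Fin K, if i.val < S then c i else 0) ∈ Set.Icc (1 : ℝ) S := by
  constructor
  · rw [← h.sum_sq]
    gcongr with i
    split_ifs with hi
    · nlinarith [h.nonneg i, h.le_one i]
    · simp [h.eq_zero i (not_lt.1 hi)]
  · calc (∑ i : Fin K, if i.val < S then c i else 0)
        ≤ ∑ i : Fin K, if i.val < S then (1 : ℝ) else 0 := by
          gcongr with i
          split_ifs
          · exact h.le_one i
          · exact le_rfl
      _ = S := by
          rw [← Finset.sum_filter, Finset.sum_const, card_filter_val_lt hSK, nsmul_eq_mul, mul_one]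

theorem gammaOne_mem_Icc (hSK : S ≤ K) {ν : Measure (Vec K)} [IsProbabilityMeasure (rearrLaw ν)]
    (h : ∀ᵐ c ∂(rearrLaw ν), IsSparseSeq S Δ c) : gammaOne ν S ∈ Set.Icc (1 : ℝ) S := by
  simp only [gammaOne, sum_entry_eq hSK]
  have hm : Measurable fun c : Fin K → ℝ => ∑ i : Fin K, if i.val < S then c i else 0 := by
    refine Finset.measurable_sum _ fun i _ => ?_
    split_ifs <;> fun_prop
  have hi : Integrable (fun c : Fin K → ℝ => ∑ i : Fin K, if i.val < S then c i else 0)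
      (rearrLaw ν) := by
    refine Integrable.of_bound hm.aestronglyMeasurable S ?_
    filter_upwards [h] with c hc
    have := hc.sum_ite_mem_Icc hSK
    rw [Real.norm_of_nonneg (zero_le_one.trans this.1)]
    exact this.2
  constructor
  · have := integral_mono_ae (integrable_const (1 : ℝ)) hi
      (h.mono fun c hc => (hc.sum_ite_mem_Icc hSK).1)
    simpa using this
  · have := integral_mono_ae hi (integrable_const (S : ℝ))
      (h.mono fun c hc => (hc.sum_ite_mem_Icc hSK).2)
    simpa using this

end Coefficients

/-! ### Deterministic properties of a signal -/

section Signal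

variable {d K S : ℕ} {Φ Ψ : Atoms d K} {A B Δ : ℝ}

theorem coherence_nonneg (Φ : Atoms d K) : 0 ≤ coherence Φ :=
  Real.iSup_nonneg fun _ => abs_nonneg _

theorem abs_inner_le_coherence (Φ : Atoms d K) {j k : Fin K} (h : j ≠ k) :
    |⟪Φ j, Φ k⟫| ≤ coherence Φ :=
  le_ciSup (f := fun q : {q : Fin K × Fin K // q.1 ≠ q.2} => |⟪Φ q.1.1, Φ q.1.2⟫|)
    (Set.finite_range _).bddAbove ⟨(j, k), h⟩

theorem one_le_frame_bound (hK : 0 < K) (hΦ : IsDictionary Φ) (hF : IsFrame Φ A B) : 1 ≤ B := by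
  have h := (hF.2.2 (Φ ⟨0, hK⟩)).2
  have h1 : |⟪Φ ⟨0, hK⟩, Φ ⟨0, hK⟩⟫| ^ 2 ≤ ∑ k, |⟪Φ k, Φ ⟨0, hK⟩⟫| ^ 2 :=
    Finset.single_le_sum (f := fun k => |⟪Φ k, Φ ⟨0, hK⟩⟫| ^ 2) (fun j _ => sq_nonneg _)
      (Finset.mem_univ _)
  rw [real_inner_self_eq_norm_sq, hΦ] at h1
  rw [hΦ] at h
  norm_num at h1 h
  linarith

theorem abs_sign_unit (u : ℤˣ) : |((u : ℤ) : ℝ)| = 1 := by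
  rcases Int.units_eq_one_or u with rfl | rfl <;> simp

theorem sign_unit_mul_self (u : ℤˣ) : ((u : ℤ) : ℝ) * ((u : ℤ) : ℝ) = 1 := by
  rcases Int.units_eq_one_or u with rfl | rfl <;> simp

theorem sum_coeff_sq (w : Draw K) (h : ∑ i, w.1 i ^ 2 = 1) :
    ∑ k, (((w.2.2 k : ℤ) : ℝ) * w.1 (w.2.1 k)) ^ 2 = 1 := by
  rw [← h, ← Equiv.sum_comp w.2.1 fun i => w.1 i ^ 2]
  refine Finset.sum_congr rfl fun k _ => ?_
  rw [mul_pow, sq ((w.2.2 k : ℤ) : ℝ), sign_unit_mul_self, one_mul]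

/-- Duality: `‖y‖²` is the pairing of the unit coefficient vector with the analysis coefficients of
`y`, so Cauchy–Schwarz and the upper frame bound give `‖y‖⁴ ≤ B ‖y‖²`. -/
theorem norm_signal_le (hF : IsFrame Φ A B) {w : Draw K} (h : ∑ i, w.1 i ^ 2 = 1) :
    ‖signal Φ w‖ ≤ √B := by
  set y := signal Φ w with hy
  rcases eq_or_ne y 0 with h0 | h0
  · rw [h0, norm_zero]
    exact Real.sqrt_nonneg _
  have hpos : 0 < ‖y‖ := norm_pos_iff.2 h0
  have h1 : ‖y‖ ^ 2 = ∑ k, (((w.2.2 k : ℤ) : ℝ) * w.1 (w.2.1 k)) * ⟪Φ k, y⟫ := by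
    rw [← real_inner_self_eq_norm_sq]
    conv_lhs => enter [2]; rw [hy, signal]
    simp only [sum_inner, real_inner_smul_left]
  have h2 := Finset.sum_mul_sq_le_sq_mul_sq Finset.univ
    (fun k => ((w.2.2 k : ℤ) : ℝ) * w.1 (w.2.1 k)) (fun k => ⟪Φ k, y⟫)
  rw [← h1, sum_coeff_sq w h, one_mul] at h2
  have h3 := (hF.2.2 y).2
  simp only [sq_abs] at h3
  refine Real.le_sqrt_of_sq_le ?_
  have h4 : ‖y‖ ^ 2 * ‖y‖ ^ 2 ≤ B * ‖y‖ ^ 2 := by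
    rw [← sq]
    exact h2.trans h3
  exact le_of_mul_le_mul_right h4 (by positivity)

theorem inner_signal (v : Vec d) (w : Draw K) :
    ⟪v, signal Φ w⟫ = ∑ j, ((w.2.2 j : ℤ) : ℝ) * (w.1 (w.2.1 j) * ⟪v, Φ j⟫) := by
  simp only [signal, inner_sum, real_inner_smul_right, mul_assoc]

theorem abs_inner_signal_sub_le (hSK : S ≤ K) (hΦ : IsDictionary Φ) {w : Draw K}
    (hw : IsSparseSeq S Δ w.1) (i : Fin K) :
    |⟪Φ i, signal Φ w⟫ - ((w.2.2 i : ℤ) : ℝ) * w.1 (w.2.1 i)| ≤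
      coherence Φ * S * entry w.1 1 := by
  rw [inner_signal, ← Finset.add_sum_erase _ _ (Finset.mem_univ i), real_inner_self_eq_norm_sq,
    hΦ]
  simp only [one_pow, mul_one, add_sub_cancel_left]
  calc |∑ j ∈ Finset.univ.erase i, ((w.2.2 j : ℤ) : ℝ) * (w.1 (w.2.1 j) * ⟪Φ i, Φ j⟫)|
      ≤ ∑ j ∈ Finset.univ.erase i, |((w.2.2 j : ℤ) : ℝ) * (w.1 (w.2.1 j) * ⟪Φ i, Φ j⟫)| :=
        Finset.abs_sum_le_sum_abs _ _
    _ ≤ ∑ j ∈ Finset.univ.erase i, w.1 (w.2.1 j) * coherence Φ := by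
        refine Finset.sum_le_sum fun j hj => ?_
        rw [abs_mul, abs_mul, abs_sign_unit, one_mul, abs_of_nonneg (hw.nonneg _)]
        exact mul_le_mul_of_nonneg_left
          (abs_inner_le_coherence Φ (Finset.ne_of_mem_erase hj).symm) (hw.nonneg _)
    _ ≤ ∑ j, w.1 (w.2.1 j) * coherence Φ :=
        Finset.sum_le_sum_of_subset_of_nonneg (Finset.subset_univ _) fun j _ _ =>
          mul_nonneg (hw.nonneg _) (coherence_nonneg Φ)
    _ = coherence Φ * ∑ j, w.1 j := by
        rw [← Finset.sum_mul, Equiv.sum_comp w.2.1 w.1, mul_comm]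
    _ ≤ coherence Φ * (S * entry w.1 1) :=
        mul_le_mul_of_nonneg_left (hw.sum_le hSK) (coherence_nonneg Φ)
    _ = _ := by ring

/-- The support of the generating coefficients. -/
def oracleSupport (S : ℕ) (p : Equiv.Perm (Fin K)) : Finset (Fin K) :=
  Finset.univ.filter fun k => (p k).val < S

theorem mem_oracleSupport {p : Equiv.Perm (Fin K)} {k : Fin K} :
    k ∈ oracleSupport S p ↔ (p k).val < S := by
  simp [oracleSupport]

theorem card_oracleSupport (hSK : S ≤ K) (p : Equiv.Perm (Fin K)) :
    (oracleSupport S p).card = S := by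
  refine Eq.trans (Finset.card_bij (fun k _ => p k) (fun k hk => ?_)
    (fun a _ b _ hab => p.injective hab) fun i hi => ⟨p.symm i, ?_, by simp⟩)
    (card_filter_val_lt hSK)
  · simpa [mem_oracleSupport] using hk
  · simpa [mem_oracleSupport] using hi

/-- Exchange argument: a selected index outside `I` could be swapped for a missing index of `I`,
which would strictly increase the sum. Hence the tie-breaking rule plays no role. -/
theorem ThresholdRule.sel_eq (T : ThresholdRule d K S) {y : Vec d} {I : Finset (Fin K)}
    (hI : I.card = S) {θ : ℝ} (hin : ∀ i ∈ I, θ < |⟪Ψ i, y⟫|) (hout : ∀ j, j ∉ I → |⟪Ψ j, y⟫| ≤ θ) :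
    T.sel Ψ y = I := by
  refine Finset.eq_of_subset_of_card_le (fun j hj => ?_) (by rw [hI, T.card_sel])
  by_contra hjI
  obtain ⟨i, hiI, his⟩ : ∃ i ∈ I, i ∉ T.sel Ψ y := by
    by_contra hno
    push Not at hno
    have := Finset.eq_of_subset_of_card_le hno (by rw [hI, T.card_sel])
    rw [← this] at hj
    exact hjI hj
  have hie : i ∉ (T.sel Ψ y).erase j := fun h => his (Finset.mem_of_mem_erase h)
  have hmax := T.sel_max Ψ y (insert i ((T.sel Ψ y).erase j)) (by
    rw [Finset.card_insert_of_notMem hie, Finset.card_erase_add_one hj, T.card_sel])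
  rw [Finset.sum_insert hie, ← Finset.add_sum_erase _ _ hj] at hmax
  have := hin i hiI
  have := hout j hjI
  linarith

/-- The draws for which some atom of `Ψ` sees too much of the perturbation `Ψ - Φ`. -/
def perturbationEvent (Φ Ψ : Atoms d K) (g : ℝ) : Set (Draw K) :=
  {w | ∃ i, g * entry w.1 1 / 2 ≤ |⟪Ψ i - Φ i, signal Φ w⟫|}

/-- The contribution of one signal to the mean of the `k`-th atom. -/
noncomputable def signalTerm (T : ThresholdRule d K S) (Ψ : Atoms d K) (k : Fin K) (y : Vec d) : Vec d :=
  (if k ∈ T.sel Ψ y then Real.sign ⟪Ψ k, y⟫ else 0) • y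

/-- The contribution of one signal when support and signs are known. -/
noncomputable def oracleTerm (S : ℕ) (Φ : Atoms d K) (k : Fin K) (w : Draw K) : Vec d :=
  (if (w.2.1 k).val < S then ((w.2.2 k : ℤ) : ℝ) else 0) • signal Φ w

theorem abs_inner_sub_lt {w : Draw K} {g : ℝ} (hSK : S ≤ K) (hΦ : IsDictionary Φ)
    (hw : IsSparseSeq S Δ w.1) (hn : w ∉ perturbationEvent Φ Ψ g) (i : Fin K) :
    |⟪Ψ i, signal Φ w⟫ - ((w.2.2 i : ℤ) : ℝ) * w.1 (w.2.1 i)| <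
      coherence Φ * S * entry w.1 1 + g * entry w.1 1 / 2 := by
  have h1 := abs_inner_signal_sub_le hSK hΦ hw i
  have h2 : |⟪Ψ i - Φ i, signal Φ w⟫| < g * entry w.1 1 / 2 := by
    simp only [perturbationEvent, Set.mem_ofPred_eq, not_exists, not_le] at hn
    exact hn i
  rw [inner_sub_left] at h2
  calc _ = |(⟪Φ i, signal Φ w⟫ - ((w.2.2 i : ℤ) : ℝ) * w.1 (w.2.1 i)) +
        (⟪Ψ i, signal Φ w⟫ - ⟪Φ i, signal Φ w⟫)| := by congr 1; ring
    _ ≤ _ := abs_add_le _ _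
    _ < _ := by linarith

/-- Crosstalk and perturbation together stay below `μS c(1) + (Δ - 2μS) c(1)/2 = Δ c(1)/2`, half of
the smallest possible nonzero coefficient. This level separates the support from its complement and
also preserves the signs. -/
theorem signalTerm_eq_oracleTerm (T : ThresholdRule d K S) (hSK : S ≤ K) (hΦ : IsDictionary Φ)
    (hΔ : 2 * coherence Φ * S < Δ) {w : Draw K} (hw : IsSparseSeq S Δ w.1)
    (hn : w ∉ perturbationEvent Φ Ψ (Δ - 2 * coherence Φ * S)) (k : Fin K) :
    signalTerm T Ψ k (signal Φ w) = oracleTerm S Φ k w := by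
  have hc := hw.first_pos
  have hb := fun i => abs_lt.1 (abs_inner_sub_lt hSK hΦ hw hn i)
  set a := entry w.1 1
  set m := coherence Φ
  have hm : 0 ≤ m * S * a := by
    have := coherence_nonneg Φ
    positivity
  have hga : 0 < (Δ - 2 * m * S) * a := mul_pos (by linarith) hc
  have hin : ∀ i ∈ oracleSupport S w.2.1,
      m * S * a + (Δ - 2 * m * S) * a / 2 < ((w.2.2 i : ℤ) : ℝ) * ⟪Ψ i, signal Φ w⟫ := by
    intro i hi
    have h1 := hw.gap _ (mem_oracleSupport.1 hi)
    have h2 := hb i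
    have h3 : Δ * a = (Δ - 2 * m * S) * a + 2 * (m * S * a) := by ring
    rcases Int.units_eq_one_or (w.2.2 i) with hs | hs
    · simp only [hs, Units.val_one, Int.cast_one, one_mul] at h2 ⊢
      linarith [h2.1]
    · simp only [hs, Units.val_neg, Units.val_one, Int.cast_neg, Int.cast_one, neg_mul, one_mul]
        at h2 ⊢
      linarith [h2.2]
  have hsel : T.sel Ψ (signal Φ w) = oracleSupport S w.2.1 := by
    refine T.sel_eq (card_oracleSupport hSK _) (fun i hi => (hin i hi).trans_le ?_)
      fun j hj => ?_
    · calc _ ≤ |((w.2.2 i : ℤ) : ℝ) * ⟪Ψ i, signal Φ w⟫| := le_abs_self _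
        _ = _ := by rw [abs_mul, abs_sign_unit, one_mul]
    · have h2 := hb j
      rw [hw.eq_zero _ (not_lt.1 fun h => hj (mem_oracleSupport.2 h)), mul_zero, sub_zero] at h2
      exact (abs_lt.2 h2).le
  rw [signalTerm, oracleTerm, hsel]
  congr 1
  by_cases hk : k ∈ oracleSupport S w.2.1
  · rw [if_pos hk, if_pos (mem_oracleSupport.1 hk)]
    have h1 := hin k hk
    rcases Int.units_eq_one_or (w.2.2 k) with hs | hs
    · simp only [hs, Units.val_one, Int.cast_one, one_mul] at h1 ⊢
      exact Real.sign_of_pos (by linarith)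
    · simp only [hs, Units.val_neg, Units.val_one, Int.cast_neg, Int.cast_one, neg_mul, one_mul]
        at h1 ⊢
      exact Real.sign_of_neg (by linarith)
  · rw [if_neg hk, if_neg fun h => hk (mem_oracleSupport.2 h)]

theorem norm_signalTerm_le (T : ThresholdRule d K S) (Ψ : Atoms d K) (k : Fin K) (y : Vec d) :
    ‖signalTerm T Ψ k y‖ ≤ ‖y‖ := by
  rw [signalTerm, norm_smul]
  refine mul_le_of_le_one_left (norm_nonneg _) ?_
  split_ifs
  · rcases Real.sign_apply_eq ⟪Ψ k, y⟫ with h | h | h <;> simp [h]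
  · simp

theorem norm_oracleTerm_le (S : ℕ) (Φ : Atoms d K) (k : Fin K) (w : Draw K) :
    ‖oracleTerm S Φ k w‖ ≤ ‖signal Φ w‖ := by
  rw [oracleTerm, norm_smul]
  refine mul_le_of_le_one_left (norm_nonneg _) ?_
  split_ifs
  · rw [Real.norm_eq_abs, abs_sign_unit]
  · simp

end Signal

/-! ### Expectations with respect to the law of a draw -/

theorem Measurable.real_sign {α : Type*} [MeasurableSpace α] {f : α → ℝ} (hf : Measurable f) :
    Measurable fun x => Real.sign (f x) := by
  simp only [Real.sign]
  exact Measurable.ite (measurableSet_lt hf measurable_const) measurable_const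
    (Measurable.ite (measurableSet_lt measurable_const hf) measurable_const measurable_const)

/-- Turns a conditional bound into an unconditional one, both given coefficients and permutation and
given the current dictionary. -/
theorem prod_apply_le_of_ae_le {α β : Type*} [MeasurableSpace α] [MeasurableSpace β]
    {μ : Measure α} {ρ : Measure β} [IsProbabilityMeasure μ] [SFinite ρ] {s : Set (α × β)}
    (hs : MeasurableSet s) {q : ENNReal} (h : ∀ᵐ x ∂μ, ρ (Prod.mk x ⁻¹' s) ≤ q) :
    μ.prod ρ s ≤ q := by
  rw [Measure.prod_apply hs]
  calc ∫⁻ x, ρ (Prod.mk x ⁻¹' s) ∂μ ≤ ∫⁻ _, q ∂μ := lintegral_mono_ae h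
    _ = q := by simp

section DrawLaw

variable {d K S : ℕ} {Φ Ψ : Atoms d K} {A B Δ : ℝ} {ν : Measure (Vec K)}

theorem measurable_signal (Φ : Atoms d K) : Measurable (signal Φ) :=
  measurable_from_prod_countable_left fun q => by
    change Measurable fun c : Fin K → ℝ => ∑ k, (((q.2 k : ℤ) : ℝ) * c (q.1 k)) • Φ k
    fun_prop

theorem measurable_oracleTerm (S : ℕ) (Φ : Atoms d K) (k : Fin K) :
    Measurable (oracleTerm S Φ k) :=
  measurable_from_prod_countable_left fun q => by
    change Measurable fun c : Fin K → ℝ => (if (q.1 k).val < S then ((q.2 k : ℤ) : ℝ) else 0) •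
      ∑ k, (((q.2 k : ℤ) : ℝ) * c (q.1 k)) • Φ k
    fun_prop

theorem measurable_signalTerm (T : ThresholdRule d K S) (k : Fin K) :
    Measurable fun q : Atoms d K × Vec d => signalTerm T q.1 k q.2 := by
  have hset : MeasurableSet {q : Atoms d K × Vec d | k ∈ T.sel q.1 q.2} := by
    have : {q : Atoms d K × Vec d | k ∈ T.sel q.1 q.2} =
        ⋃ I : Finset (Fin K), ⋃ _ : k ∈ I, {q | T.sel q.1 q.2 = I} := by
      ext q
      simp
    rw [this]
    exact .iUnion fun I => .iUnion fun _ => T.measurableSet_sel I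
  have hin : Measurable fun q : Atoms d K × Vec d => ⟪q.1 k, q.2⟫ := by fun_prop
  exact (Measurable.ite hset hin.real_sign measurable_const).smul measurable_snd

theorem measurableSet_perturbationEvent (Φ Ψ : Atoms d K) (g : ℝ) :
    MeasurableSet (perturbationEvent Φ Ψ g) := by
  have h : perturbationEvent Φ Ψ g =
      ⋃ i, {w | g * entry w.1 1 / 2 ≤ |⟪Ψ i - Φ i, signal Φ w⟫|} := by
    ext w
    simp [perturbationEvent]
  rw [h]
  have h1 : Measurable fun w : Draw K => entry w.1 1 := (measurable_entry 1).comp measurable_fst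
  have h2 := measurable_signal Φ
  refine .iUnion fun i => measurableSet_le ((h1.const_mul g).div_const 2) ?_
  have h3 : Measurable fun w => ⟪Ψ i - Φ i, signal Φ w⟫ := measurable_const.inner h2
  exact h3.abs

theorem ae_drawLaw_of_ae {p : (Fin K → ℝ) → Prop} (h : ∀ᵐ c ∂(rearrLaw ν), p c) :
    ∀ᵐ w ∂(drawLaw ν), p w.1 :=
  Measure.quasiMeasurePreserving_fst.ae h

variable [IsProbabilityMeasure (rearrLaw ν)]

instance isProbabilityMeasure_drawLaw : IsProbabilityMeasure (drawLaw ν) := by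
  unfold drawLaw
  infer_instance

theorem integral_drawLaw {F : Type*} [NormedAddCommGroup F] [NormedSpace ℝ F]
    {f : Draw K → F} (hf : Integrable f (drawLaw ν)) :
    ∫ w, f w ∂(drawLaw ν) = ∫ c, ∫ p, ∫ σ, f (c, p, σ) ∂(uniformOn Set.univ)
      ∂(uniformOn Set.univ) ∂(rearrLaw ν) := by
  rw [drawLaw, integral_prod _ hf]
  congr 1
  ext c
  rw [integral_prod _ .of_finite]

theorem integrable_oracleTerm (hF : IsFrame Φ A B) (h : ∀ᵐ c ∂(rearrLaw ν), IsSparseSeq S Δ c)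
    (k : Fin K) : Integrable (oracleTerm S Φ k) (drawLaw ν) := by
  refine Integrable.of_bound (measurable_oracleTerm S Φ k).aestronglyMeasurable √B ?_
  filter_upwards [ae_drawLaw_of_ae h] with w hw
  exact (norm_oracleTerm_le S Φ k w).trans (norm_signal_le hF hw.sum_sq)

theorem integrable_norm_oracleTerm_sq (hF : IsFrame Φ A B)
    (h : ∀ᵐ c ∂(rearrLaw ν), IsSparseSeq S Δ c) (k : Fin K) :
    Integrable (fun w => ‖oracleTerm S Φ k w‖ ^ 2) (drawLaw ν) := by
  refine Integrable.of_bound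
    ((measurable_oracleTerm S Φ k).norm.pow_const 2).aestronglyMeasurable (√B ^ 2) ?_
  filter_upwards [ae_drawLaw_of_ae h] with w hw
  rw [Real.norm_of_nonneg (by positivity)]
  gcongr
  exact (norm_oracleTerm_le S Φ k w).trans (norm_signal_le hF hw.sum_sq)

/-- Averaging over the signs removes all atoms except `φ_k`; averaging over the permutations
replaces its coefficient by the mean of the sorted sequence, cut off after `S` entries. -/
theorem integral_oracleTerm (hSK : S ≤ K) (hF : IsFrame Φ A B)
    (h : ∀ᵐ c ∂(rearrLaw ν), IsSparseSeq S Δ c) (k : Fin K) :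
    ∫ w, oracleTerm S Φ k w ∂(drawLaw ν) = (gammaOne ν S / K) • Φ k := by
  rw [integral_drawLaw (integrable_oracleTerm hF h k)]
  have h1 : ∀ (c : Fin K → ℝ) (p : Equiv.Perm (Fin K)),
      ∫ σ, oracleTerm S Φ k (c, p, σ) ∂(uniformOn Set.univ) =
        (fun i : Fin K => if i.val < S then c i else 0) (p k) • Φ k := by
    intro c p
    simp only [oracleTerm, signal, mul_smul]
    split_ifs with hk
    · exact integral_sign_smul_sum k fun j => c (p j) • Φ j
    · simp
  have h2 : ∀ c : Fin K → ℝ, ∫ p, ∫ σ, oracleTerm S Φ k (c, p, σ) ∂(uniformOn Set.univ)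
      ∂(uniformOn Set.univ) = ((∑ i : Fin K, if i.val < S then c i else 0) / K) • Φ k := by
    intro c
    simp only [h1]
    rw [integral_smul_const, integral_perm_apply (fun i : Fin K => if i.val < S then c i else 0)]
  simp only [h2]
  rw [integral_smul_const, integral_div]
  simp only [gammaOne, sum_entry_eq hSK]

/-- By orthogonality of the signs the squared norm of a signal averages to `1`, so only the chance
`S/K` that `k` lies in the support remains. The crude bound by `B` would spoil the exponent. -/
theorem integral_norm_oracleTerm_sq (hSK : S ≤ K) (hΦ : IsDictionary Φ) (hF : IsFrame Φ A B)
    (h : ∀ᵐ c ∂(rearrLaw ν), IsSparseSeq S Δ c) (k : Fin K) :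
    ∫ w, ‖oracleTerm S Φ k w‖ ^ 2 ∂(drawLaw ν) = (S : ℝ) / K := by
  rw [integral_drawLaw (integrable_norm_oracleTerm_sq hF h k)]
  have h1 : ∀ c : Fin K → ℝ, ∑ i, c i ^ 2 = 1 → ∀ p : Equiv.Perm (Fin K),
      ∫ σ, ‖oracleTerm S Φ k (c, p, σ)‖ ^ 2 ∂(uniformOn Set.univ) =
        (fun i : Fin K => if i.val < S then (1 : ℝ) else 0) (p k) := by
    intro c hc p
    simp only [oracleTerm, signal, mul_smul, norm_smul, mul_pow]
    split_ifs with hk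
    · simp only [Real.norm_eq_abs, abs_sign_unit, one_pow, one_mul]
      rw [integral_norm_sum_sign_sq fun j => c (p j) • Φ j, ← hc,
        ← Equiv.sum_comp p fun i => c i ^ 2]
      refine Finset.sum_congr rfl fun j _ => ?_
      rw [norm_smul, hΦ, mul_one, Real.norm_eq_abs, sq_abs]
    · simp
  have h2 : ∀ᵐ c ∂(rearrLaw ν), ∫ p, ∫ σ, ‖oracleTerm S Φ k (c, p, σ)‖ ^ 2 ∂(uniformOn Set.univ)
      ∂(uniformOn Set.univ) = (S : ℝ) / K := by
    filter_upwards [h] with c hc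
    simp only [h1 c hc.sum_sq]
    rw [integral_perm_apply (fun i : Fin K => if i.val < S then (1 : ℝ) else 0),
      ← Finset.sum_filter, Finset.sum_const, card_filter_val_lt hSK, nsmul_eq_mul, mul_one]
  rw [integral_congr_ae h2]
  simp

/-- With `c` and `p` fixed, Hoeffding applies with variance proxy `c(1)² B e²` against the level `g
c(1)/2`; the factor `c(1)` cancels, so the bound is uniform. The prefactor `K` is a union bound over
the atoms. -/
theorem drawLaw_perturbationEvent_le (hB : 0 < B) (hF : IsFrame Φ A B)
    (h : ∀ᵐ c ∂(rearrLaw ν), IsSparseSeq S Δ c) {e g : ℝ} (he : 0 < e) (hg : 0 < g)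
    (hΨ : ∀ k, ‖Ψ k - Φ k‖ ≤ e) :
    (drawLaw ν).real (perturbationEvent Φ Ψ g) ≤
      2 * K * Real.exp (-(g ^ 2 / (8 * B * e ^ 2))) := by
  refine ENNReal.toReal_le_of_le_ofReal (by positivity) ?_
  have hm := measurableSet_perturbationEvent Φ Ψ g
  refine prod_apply_le_of_ae_le hm ?_
  filter_upwards [h] with c hc
  refine prod_apply_le_of_ae_le (hm.preimage measurable_prodMk_left) (.of_forall fun p => ?_)
  have hc0 := hc.first_pos
  set a := entry c 1 with ha
  rw [← ofReal_measureReal]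
  refine ENNReal.ofReal_le_ofReal ?_
  have hset : Prod.mk p ⁻¹' (Prod.mk c ⁻¹' perturbationEvent Φ Ψ g) =
      ⋃ i, {σ : Fin K → ℤˣ | g * a / 2 ≤
        |∑ j, ((σ j : ℤ) : ℝ) * (c (p j) * ⟪Ψ i - Φ i, Φ j⟫)|} := by
    ext σ
    simp [perturbationEvent, inner_signal, ha]
  rw [hset]
  refine (measureReal_iUnion_fintype_le _).trans ?_
  have hone : ∀ i, (uniformOn (Set.univ : Set (Fin K → ℤˣ))).real {σ | g * a / 2 ≤
      |∑ j, ((σ j : ℤ) : ℝ) * (c (p j) * ⟪Ψ i - Φ i, Φ j⟫)|} ≤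
        2 * Real.exp (-(g ^ 2 / (8 * B * e ^ 2))) := by
    intro i
    refine (measureReal_le_abs_sum_sign_le (V := a ^ 2 * (B * e ^ 2)) _ (by positivity)
      (by positivity) ?_).trans (le_of_eq ?_)
    · calc ∑ j, (c (p j) * ⟪Ψ i - Φ i, Φ j⟫) ^ 2
          ≤ ∑ j, a ^ 2 * |⟪Φ j, Ψ i - Φ i⟫| ^ 2 := by
            refine Finset.sum_le_sum fun j _ => ?_
            rw [mul_pow, sq_abs, real_inner_comm]
            have h1 := hc.nonneg (p j)
            have h2 := hc.le_first (p j)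
            gcongr
        _ ≤ a ^ 2 * (B * e ^ 2) := by
            rw [← Finset.mul_sum]
            have h1 := (hF.2.2 (Ψ i - Φ i)).2
            have h2 := hΨ i
            have h3 : B * ‖Ψ i - Φ i‖ ^ 2 ≤ B * e ^ 2 := by gcongr
            gcongr
            exact h1.trans h3
    · congr 3
      field_simp
      ring
  refine (Finset.sum_le_sum fun i _ => hone i).trans (le_of_eq ?_)
  simp
  ring

end DrawLaw

/-! ### One iteration -/

theorem four_le_log_of_le {Q : ℝ} (h : 1060 ≤ Q) : 4 ≤ Real.log Q := by
  rw [Real.le_log_iff_exp_le (by linarith)]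
  have h1 : Real.exp 4 = Real.exp 1 ^ 4 := by rw [← Real.exp_nat_mul]; norm_num
  have h2 := Real.exp_one_lt_d9
  rw [h1]
  calc Real.exp 1 ^ 4 ≤ 3 ^ 4 := by gcongr; linarith
    _ ≤ Q := by linarith

/-! ### Numerical consequences of the convergence radius -/

section Radius

variable {K S : ℕ} {B μ Δ γ e : ℝ}

theorem log_argument_ge (hSK : S ≤ K) (hB : 1 ≤ B) (hg : 0 < Δ - 2 * μ * S)
    (hg1 : Δ - 2 * μ * S ≤ 1) (hγ : 1 ≤ γ) (hγS : γ ≤ S) :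
    1060 ≤ 1060 * (K : ℝ) ^ 2 * B / ((Δ - 2 * μ * S) * γ) := by
  have hSK' : (S : ℝ) ≤ K := by exact_mod_cast hSK
  rw [le_div_iff₀ (by positivity)]
  have h1 : (Δ - 2 * μ * S) * γ ≤ 1 * γ := by gcongr
  have h2 : γ * 1 * 1 ≤ (K : ℝ) * K * B := by
    gcongr <;> linarith
  nlinarith

theorem mul_sqrt_le_of_le_convRadius (hSK : S ≤ K) (hB : 1 ≤ B) (hg : 0 < Δ - 2 * μ * S)
    (hg1 : Δ - 2 * μ * S ≤ 1) (hγ : 1 ≤ γ) (hγS : γ ≤ S) (he : e ≤ convRadius K S B μ Δ γ) :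
    e * √B ≤ 1 / 20 := by
  have hL := four_le_log_of_le (log_argument_ge hSK hB hg hg1 hγ hγS)
  rw [convRadius] at he
  set L := Real.log (1060 * (K : ℝ) ^ 2 * B / ((Δ - 2 * μ * S) * γ))
  have h2 : 2 ≤ √L := Real.le_sqrt_of_sq_le (by linarith)
  have h9 : (9 : ℝ) ≤ √98 := Real.le_sqrt_of_sq_le (by norm_num)
  have hsB : 0 < √B := Real.sqrt_pos.2 (by linarith)
  rw [le_div_iff₀ (by positivity), Real.sqrt_mul (by norm_num)] at he
  -- The product `9 * (1/4 + 2) = 20.25` just exceeds `20`, whence the `1/20`.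
  have h3 : (9 : ℝ) * (1 / 4 + 2) ≤ √98 * (1 / 4 + √L) := by gcongr
  by_contra hcon
  push Not at hcon
  have h4 : 1 / 20 * (9 * (1 / 4 + 2)) < e * √B * (√98 * (1 / 4 + √L)) :=
    mul_lt_mul hcon h3 (by norm_num) (by linarith)
  have h5 : e * √B * (√98 * (1 / 4 + √L)) = e * (√98 * √B * (1 / 4 + √L)) := by ring
  linarith

theorem perturbation_bound_le (hSK : S ≤ K) (hB : 1 ≤ B) (hg : 0 < Δ - 2 * μ * S)
    (hg1 : Δ - 2 * μ * S ≤ 1) (hγ : 1 ≤ γ) (hγS : γ ≤ S) (he0 : 0 < e)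
    (he : e ≤ convRadius K S B μ Δ γ) :
    2 * √B * (2 * K * Real.exp (-((Δ - 2 * μ * S) ^ 2 / (8 * B * e ^ 2)))) ≤
      e * γ / (20 * K) := by
  have hQ := log_argument_ge hSK hB hg hg1 hγ hγS
  have hL := four_le_log_of_le hQ
  have hSK' : (S : ℝ) ≤ K := by exact_mod_cast hSK
  have hK : (0 : ℝ) < K := by linarith
  rw [convRadius] at he
  set g := Δ - 2 * μ * S
  set Q := 1060 * (K : ℝ) ^ 2 * B / (g * γ) with hQd
  set L := Real.log Q with hLd
  have hsB : 0 < √B := Real.sqrt_pos.2 (by linarith)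
  have hBB : √B ^ 2 = B := Real.sq_sqrt (by linarith)
  have hQ0 : 0 < Q := by linarith
  rw [le_div_iff₀ (by positivity), Real.sqrt_mul (by norm_num)] at he
  set z := g ^ 2 / (B * e ^ 2) with hz
  have hz98 : 98 * L ≤ z := by
    rw [hz, le_div_iff₀ (by positivity)]
    have h1 : (e * (√98 * √B * (1 / 4 + √L))) ^ 2 ≤ g ^ 2 := by gcongr
    have h2 : (e * (√98 * √B * (1 / 4 + √L))) ^ 2 = 98 * (B * e ^ 2) * (1 / 4 + √L) ^ 2 := by
      rw [mul_pow, mul_pow, mul_pow, hBB, Real.sq_sqrt (by norm_num)]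
      ring
    have h3 : L ≤ (1 / 4 + √L) ^ 2 := by
      have := Real.sq_sqrt (show 0 ≤ L by linarith)
      have := Real.sqrt_nonneg L
      nlinarith
    have h4 : 98 * (B * e ^ 2) * L ≤ 98 * (B * e ^ 2) * (1 / 4 + √L) ^ 2 := by gcongr
    linarith
  have hz0 : 0 < z := by linarith
  -- As `z/8 - z/9 = z/72` and `98/72 ≥ 1`, one part of the exponent pays for `Q⁻¹`, which absorbs
  -- `K` and `γ`. The rest, `exp (-(z/9)) ≤ 9/z`, is quadratic in `e`; one factor `e` is kept and
  -- the other is spent in `√B * e / g ≤ 1`. The final constant is `36/1060 ≤ 1/20`.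
  have hexp : Real.exp (-(z / 8)) ≤ Q⁻¹ * (9 / z) := by
    calc Real.exp (-(z / 8)) ≤ Real.exp (-L + -(z / 9)) := by
          gcongr
          linarith
      _ = Q⁻¹ * Real.exp (-(z / 9)) := by
          rw [Real.exp_add, Real.exp_neg, hLd, Real.exp_log hQ0]
      _ ≤ Q⁻¹ * (9 / z) := by
          gcongr
          rw [Real.exp_neg, ← inv_div z 9]
          exact inv_anti₀ (by positivity) (by linarith [Real.add_one_le_exp (z / 9)])
  have hg2 : g ^ 2 / (8 * B * e ^ 2) = z / 8 := by
    rw [hz]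
    field_simp
  have hle : √B * e ≤ g := by
    refine abs_le_of_sq_le_sq' ?_ hg.le |>.2
    have h1 : 1 ≤ z := by linarith
    rw [hz, le_div_iff₀ (by positivity)] at h1
    rw [mul_pow, hBB]
    linarith
  rw [hg2]
  calc 2 * √B * (2 * K * Real.exp (-(z / 8)))
      ≤ 2 * √B * (2 * K * (Q⁻¹ * (9 / z))) := by gcongr
    _ = 36 / 1060 * (e * γ / K) * (√B * e / g) := by
        rw [hQd, hz]
        field_simp
        norm_num
    _ ≤ 36 / 1060 * (e * γ / K) * 1 := by
        gcongr
        exact (div_le_one hg).2 hle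
    _ ≤ _ := by
        have h1 : e * γ / (20 * K) = 1 / 20 * (e * γ / K) := by field_simp
        have h2 : 0 < e * γ / K := by positivity
        rw [h1]
        nlinarith

end Radius

/-- The error splits into the wrong length of `x` and its distance to `s • φ`, each at most `s * t`.
The condition `t < 1` keeps `x` away from zero. -/
theorem norm_normalize_sub_le {E : Type*} [NormedAddCommGroup E] [NormedSpace ℝ E] {x φ : E}
    {s t : ℝ} (hφ : ‖φ‖ = 1) (hs : 0 < s) (ht : t < 1) (h : ‖x - s • φ‖ ≤ s * t) :
    ‖‖x‖⁻¹ • x - φ‖ ≤ 2 * t := by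
  have h1 : |‖x‖ - s| ≤ s * t := by
    have h2 := abs_norm_sub_norm_le x (s • φ)
    rw [norm_smul, hφ, mul_one, Real.norm_of_nonneg hs.le] at h2
    exact h2.trans h
  have hx : 0 < ‖x‖ := by
    have h2 := (abs_le.1 h1).1
    nlinarith
  have h3 : s • (‖x‖⁻¹ • x - φ) = (s - ‖x‖) • (‖x‖⁻¹ • x) + (x - s • φ) := by
    rw [smul_sub, sub_smul, smul_smul ‖x‖, mul_inv_cancel₀ hx.ne', one_smul]
    abel
  have h4 : s * ‖‖x‖⁻¹ • x - φ‖ ≤ s * t + s * t := by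
    calc s * ‖‖x‖⁻¹ • x - φ‖ = ‖s • (‖x‖⁻¹ • x - φ)‖ := by
          rw [norm_smul, Real.norm_of_nonneg hs.le]
      _ ≤ ‖(s - ‖x‖) • (‖x‖⁻¹ • x)‖ + ‖x - s • φ‖ := by rw [h3]; exact norm_add_le _ _
      _ ≤ s * t + s * t := by
          refine add_le_add ?_ h
          rw [norm_smul, norm_smul, norm_inv, norm_norm, inv_mul_cancel₀ hx.ne', mul_one,
            Real.norm_eq_abs, abs_sub_comm]
          exact h1
  have h5 : s * ‖‖x‖⁻¹ • x - φ‖ ≤ s * (2 * t) := by linarith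
  exact le_of_mul_le_mul_left h5 hs

theorem integral_norm_sub_integral_sq_le {α E : Type*} [MeasurableSpace α] {μ : Measure α}
    [IsProbabilityMeasure μ] [NormedAddCommGroup E] [InnerProductSpace ℝ E] [CompleteSpace E]
    {f : α → E} (hf : Integrable f μ) (hf2 : Integrable (fun x => ‖f x‖ ^ 2) μ) :
    ∫ x, ‖f x - ∫ y, f y ∂μ‖ ^ 2 ∂μ ≤ ∫ x, ‖f x‖ ^ 2 ∂μ := by
  set m := ∫ y, f y ∂μ with hm
  have hi : Integrable (fun x => ⟪m, f x⟫) μ := hf.const_inner m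
  have h1 : ∀ x, ‖f x - m‖ ^ 2 = ‖f x‖ ^ 2 - 2 * ⟪m, f x⟫ + ‖m‖ ^ 2 := fun x => by
    rw [norm_sub_sq_real, real_inner_comm]
  have hi2 : Integrable (fun x => ‖f x‖ ^ 2 - 2 * ⟪m, f x⟫) μ := hf2.sub (hi.const_mul 2)
  simp only [h1]
  rw [integral_add hi2 (integrable_const _), integral_sub hf2 (hi.const_mul 2),
    integral_const_mul, integral_inner hf, ← hm, real_inner_self_eq_norm_sq]
  simp only [integral_const, probReal_univ, one_smul]
  nlinarith [sq_nonneg ‖m‖]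

/-! ### Bias, second moment and concentration of the signal means -/

section Step

variable {d K S N : ℕ} {Φ Ψ : Atoms d K} {A B Δ e : ℝ} {ν : Measure (Vec K)}
  [IsProbabilityMeasure (rearrLaw ν)] {Ω : Type*} [MeasurableSpace Ω] {P : Measure Ω}
  [IsProbabilityMeasure P]

theorem measurable_signalTerm_signal (T : ThresholdRule d K S) (Φ Ψ : Atoms d K) (k : Fin K) :
    Measurable fun w => signalTerm T Ψ k (signal Φ w) :=
  (measurable_signalTerm T k).comp (measurable_const.prodMk (measurable_signal Φ))

theorem integrable_signalTerm (T : ThresholdRule d K S) (hF : IsFrame Φ A B)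
    (h : ∀ᵐ c ∂(rearrLaw ν), IsSparseSeq S Δ c) (k : Fin K) :
    Integrable (fun w => signalTerm T Ψ k (signal Φ w)) (drawLaw ν) := by
  refine Integrable.of_bound (measurable_signalTerm_signal T Φ Ψ k).aestronglyMeasurable √B ?_
  filter_upwards [ae_drawLaw_of_ae h] with w hw
  exact (norm_signalTerm_le T Ψ k _).trans (norm_signal_le hF hw.sum_sq)

theorem integrable_norm_signalTerm_sq (T : ThresholdRule d K S) (hF : IsFrame Φ A B)
    (h : ∀ᵐ c ∂(rearrLaw ν), IsSparseSeq S Δ c) (k : Fin K) :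
    Integrable (fun w => ‖signalTerm T Ψ k (signal Φ w)‖ ^ 2) (drawLaw ν) := by
  refine Integrable.of_bound
    ((measurable_signalTerm_signal T Φ Ψ k).norm.pow_const 2).aestronglyMeasurable (√B ^ 2) ?_
  filter_upwards [ae_drawLaw_of_ae h] with w hw
  rw [Real.norm_of_nonneg (by positivity)]
  gcongr
  exact (norm_signalTerm_le T Ψ k _).trans (norm_signal_le hF hw.sum_sq)

/-- The two integrands agree off the perturbation event, and on it each has norm at most `√B`. -/
theorem norm_integral_signalTerm_sub_le (T : ThresholdRule d K S) (hSK : S ≤ K)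
    (hΦ : IsDictionary Φ) (hF : IsFrame Φ A B) (h : ∀ᵐ c ∂(rearrLaw ν), IsSparseSeq S Δ c)
    (hΔ : 2 * coherence Φ * S < Δ) (k : Fin K) :
    ‖∫ w, signalTerm T Ψ k (signal Φ w) ∂(drawLaw ν) - (gammaOne ν S / K) • Φ k‖ ≤
      2 * √B * (drawLaw ν).real (perturbationEvent Φ Ψ (Δ - 2 * coherence Φ * S)) := by
  have hm := measurableSet_perturbationEvent Φ Ψ (Δ - 2 * coherence Φ * S)
  rw [← integral_oracleTerm hSK hF h k,
    ← integral_sub (integrable_signalTerm T hF h k) (integrable_oracleTerm hF h k)]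
  have h1 : ∫ w, (perturbationEvent Φ Ψ (Δ - 2 * coherence Φ * S)).indicator
      (fun _ => 2 * √B) w ∂(drawLaw ν) =
      2 * √B * (drawLaw ν).real (perturbationEvent Φ Ψ (Δ - 2 * coherence Φ * S)) := by
    rw [integral_indicator_const _ hm, smul_eq_mul, mul_comm]
  rw [← h1]
  refine norm_integral_le_of_norm_le ((integrable_const _).indicator hm) ?_
  filter_upwards [ae_drawLaw_of_ae h] with w hw
  by_cases hn : w ∈ perturbationEvent Φ Ψ (Δ - 2 * coherence Φ * S)
  · rw [Set.indicator_of_mem hn]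
    have h2 := norm_signal_le hF hw.sum_sq
    have h3 := norm_signalTerm_le T Ψ k (signal Φ w)
    have h4 := norm_oracleTerm_le S Φ k w
    have h5 := norm_sub_le (signalTerm T Ψ k (signal Φ w)) (oracleTerm S Φ k w)
    linarith
  · rw [Set.indicator_of_notMem hn, signalTerm_eq_oracleTerm T hSK hΦ hΔ hw hn k, sub_self,
      norm_zero]

theorem integral_norm_signalTerm_sq_le (T : ThresholdRule d K S) (hSK : S ≤ K)
    (hΦ : IsDictionary Φ) (hF : IsFrame Φ A B) (h : ∀ᵐ c ∂(rearrLaw ν), IsSparseSeq S Δ c)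
    (hΔ : 2 * coherence Φ * S < Δ) (hB : 0 ≤ B) (k : Fin K) :
    ∫ w, ‖signalTerm T Ψ k (signal Φ w)‖ ^ 2 ∂(drawLaw ν) ≤ (S : ℝ) / K +
      B * (drawLaw ν).real (perturbationEvent Φ Ψ (Δ - 2 * coherence Φ * S)) := by
  have hm := measurableSet_perturbationEvent Φ Ψ (Δ - 2 * coherence Φ * S)
  have h1 : ∫ w, (perturbationEvent Φ Ψ (Δ - 2 * coherence Φ * S)).indicator
      (fun _ => B) w ∂(drawLaw ν) =
      B * (drawLaw ν).real (perturbationEvent Φ Ψ (Δ - 2 * coherence Φ * S)) := by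
    rw [integral_indicator_const _ hm, smul_eq_mul, mul_comm]
  have hi : Integrable ((perturbationEvent Φ Ψ (Δ - 2 * coherence Φ * S)).indicator
      fun _ => B) (drawLaw ν) := (integrable_const _).indicator hm
  have ho := integrable_norm_oracleTerm_sq hF h k
  rw [← h1, ← integral_norm_oracleTerm_sq hSK hΦ hF h k, ← integral_add ho hi]
  refine integral_mono_ae (integrable_norm_signalTerm_sq T hF h k) (ho.add hi) ?_
  filter_upwards [ae_drawLaw_of_ae h] with w hw
  by_cases hn : w ∈ perturbationEvent Φ Ψ (Δ - 2 * coherence Φ * S)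
  · rw [Set.indicator_of_mem hn]
    have h2 := (norm_signalTerm_le T Ψ k (signal Φ w)).trans (norm_signal_le hF hw.sum_sq)
    have h3 : ‖signalTerm T Ψ k (signal Φ w)‖ ^ 2 ≤ √B ^ 2 := by gcongr
    rw [Real.sq_sqrt hB] at h3
    have := sq_nonneg ‖oracleTerm S Φ k w‖
    linarith
  · rw [Set.indicator_of_notMem hn, signalTerm_eq_oracleTerm T hSK hΦ hΔ hw hn k, add_zero]

theorem signalMean_eq (T : ThresholdRule d K S) (y : Fin N → Vec d) (Ψ : Atoms d K) (k : Fin K) :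
    signalMean T y Ψ k = (1 / (N : ℝ)) • ∑ n, signalTerm T Ψ k (y n) := rfl

theorem measure_lt_norm_signalMean_sub_le (T : ThresholdRule d K S) (hS : 1 ≤ S) (hSK : S ≤ K)
    (hΦ : IsDictionary Φ) (hF : IsFrame Φ A B) (h : ∀ᵐ c ∂(rearrLaw ν), IsSparseSeq S Δ c)
    (hΔ : 2 * coherence Φ * S < Δ) (hΔ1 : Δ ≤ 1) (he0 : 0 < e)
    (he : e ≤ convRadius K S B (coherence Φ) Δ (gammaOne ν S)) (hΨ : ∀ k, ‖Ψ k - Φ k‖ ≤ e)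
    {w : Fin N → Ω → Draw K} (hw : ∀ n, Measurable (w n)) (hlaw : ∀ n, P.map (w n) = drawLaw ν)
    (hind : iIndepFun w P) (k : Fin K) :
    P {ω | gammaOne ν S / K * (3 / 10 * e) <
        ‖signalMean T (fun n => signal Φ (w n ω)) Ψ k - (gammaOne ν S / K) • Φ k‖} ≤
      ENNReal.ofReal (2 * Real.exp (-(gammaOne ν S ^ 2 * N * e ^ 2 / (128 * S * K)))) := by
  have hK : 0 < K := hS.trans hSK
  have hB := one_le_frame_bound hK hΦ hF
  obtain ⟨hγ, hγS⟩ := gammaOne_mem_Icc hSK h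
  have hg : 0 < Δ - 2 * coherence Φ * S := by linarith
  have hg1 : Δ - 2 * coherence Φ * S ≤ 1 := by
    have := coherence_nonneg Φ
    have : 0 ≤ 2 * coherence Φ * S := by positivity
    linarith
  have hK' : (0 : ℝ) < K := by exact_mod_cast hK
  have hS' : (0 : ℝ) < S := by linarith
  have hq := drawLaw_perturbationEvent_le (Ψ := Ψ) (by linarith) hF h he0 hg hΨ
  have hb1 := perturbation_bound_le hSK hB hg hg1 hγ hγS he0 he
  have hb2 := mul_sqrt_le_of_le_convRadius hSK hB hg hg1 hγ hγS he
  set γ := gammaOne ν S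
  set q := (drawLaw ν).real (perturbationEvent Φ Ψ (Δ - 2 * coherence Φ * S)) with hqd
  have hsB : 0 < √B := Real.sqrt_pos.2 (by linarith)
  have hBB : √B * √B = B := Real.mul_self_sqrt (by linarith)
  have hq1 : 2 * √B * q ≤ e * γ / (20 * K) := (by gcongr : 2 * √B * q ≤ _).trans hb1
  have hm := norm_integral_signalTerm_sub_le (Ψ := Ψ) T hSK hΦ hF h hΔ k
  have hv := integral_norm_signalTerm_sq_le (Ψ := Ψ) T hSK hΦ hF h hΔ (by linarith) k
  rw [← hqd] at hm hv
  -- The rare event at most doubles the oracle second moment, so `2 * (S / K)` serves as variance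
  -- below.
  have hBq : B * q ≤ S / K := by
    have h1 : B * q = √B / 2 * (2 * √B * q) := by linear_combination (-q) * hBB
    have h2 : √B / 2 * (e * γ / (20 * K)) = e * √B / 40 * (γ / K) := by field_simp; ring
    calc B * q ≤ √B / 2 * (e * γ / (20 * K)) := by rw [h1]; gcongr
      _ = e * √B / 40 * (γ / K) := h2
      _ ≤ 1 * (S / K) := by
          gcongr
          linarith
      _ = _ := one_mul _
  set f : Draw K → Vec d := fun x => signalTerm T Ψ k (signal Φ x) with hf
  have hfm : Measurable f := measurable_signalTerm_signal T Φ Ψ k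
  have hfi : Integrable f (drawLaw ν) := integrable_signalTerm T hF h k
  set m := ∫ x, f x ∂(drawLaw ν) with hmd
  have hfb : ∀ᵐ x ∂(drawLaw ν), ‖f x‖ ≤ √B := by
    filter_upwards [ae_drawLaw_of_ae h] with x hx
    exact (norm_signalTerm_le T Ψ k _).trans (norm_signal_le hF hx.sum_sq)
  have hmb : ‖m‖ ≤ √B := by simpa using norm_integral_le_of_norm_le_const hfb
  rcases Nat.eq_zero_or_pos N with hN | hN
  -- For an empty batch the claimed bound equals `2` and is vacuous.
  · refine prob_le_one.trans ?_
    rw [ENNReal.one_le_ofReal]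
    simp [hN]
  have hN' : (0 : ℝ) < N := by exact_mod_cast hN
  have hfm' : Measurable fun x => f x - m := hfm.sub_const m
  have hconc := measure_lt_norm_sum_le (P := P) (X := fun n ω => f (w n ω) - m)
    (v := 2 * (S / K)) (M := 2 * √B) (t := e * γ / (4 * K))
    (fun n => hfm'.comp (hw n)) (hind.comp (fun _ x => f x - m) fun _ => hfm')
    ?_ ?_ ?_ (by positivity) (by positivity) ?_
  · have hexp : (N : ℝ) * (e * γ / (4 * K)) ^ 2 / (4 * (2 * (S / K))) =
        γ ^ 2 * N * e ^ 2 / (128 * S * K) := by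
      field_simp
      norm_num
    rw [hexp] at hconc
    refine (measure_mono fun ω hω => ?_).trans hconc
    simp only [Set.mem_ofPred_eq] at hω ⊢
    rw [signalMean_eq] at hω
    have h1 : ∑ n, (f (w n ω) - m) =
        (N : ℝ) • ((1 / (N : ℝ)) • ∑ n, signalTerm T Ψ k (signal Φ (w n ω)) - m) := by
      rw [smul_sub, smul_smul, mul_one_div_cancel hN'.ne', one_smul, Finset.sum_sub_distrib]
      simp [hf, Nat.cast_smul_eq_nsmul]
    rw [h1, norm_smul, Real.norm_of_nonneg hN'.le]
    gcongr
    have h2 := norm_sub_le_norm_sub_add_norm_sub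
      ((1 / (N : ℝ)) • ∑ n, signalTerm T Ψ k (signal Φ (w n ω))) m ((γ / K) • Φ k)
    -- Error budget: `1/4` for the fluctuation and `1/20` for the bias.
    have h3 : γ / K * (3 / 10 * e) = e * γ / (4 * K) + e * γ / (20 * K) := by
      field_simp
      norm_num
    linarith
  · intro n
    have h1 : ∀ᵐ x ∂(P.map (w n)), ‖f x - m‖ ≤ 2 * √B := by
      rw [hlaw n]
      filter_upwards [hfb] with x hx
      linarith [norm_sub_le (f x) m]
    exact ae_of_ae_map (hw n).aemeasurable h1
  · intro n
    rw [← integral_map (f := fun x => f x - m) (hw n).aemeasurable hfm'.aestronglyMeasurable,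
      hlaw n, integral_sub hfi (integrable_const _)]
    simp [← hmd]
  · intro n
    rw [← integral_map (f := fun x => ‖f x - m‖ ^ 2) (hw n).aemeasurable
      (hfm'.norm.pow_const 2).aestronglyMeasurable, hlaw n]
    have := integral_norm_sub_integral_sq_le hfi (integrable_norm_signalTerm_sq T hF h k)
    rw [← hmd] at this
    linarith
  · have h1 : e * γ / (4 * K) * (2 * √B) = e * √B / 2 * (γ / K) := by field_simp; ring
    have h2 : (0 : ℝ) < S / K := by positivity
    calc e * γ / (4 * K) * (2 * √B) = e * √B / 2 * (γ / K) := h1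
      _ ≤ 1 * (S / K) := by
          gcongr
          linarith
      _ ≤ _ := by linarith

/-- With high probability one iteration contracts the distance to `Φ`. -/
theorem measure_not_itksmStep_close_le (T : ThresholdRule d K S) (hS : 1 ≤ S) (hSK : S ≤ K)
    (hΦ : IsDictionary Φ) (hF : IsFrame Φ A B) (h : ∀ᵐ c ∂(rearrLaw ν), IsSparseSeq S Δ c)
    (hΔ : 2 * coherence Φ * S < Δ) (hΔ1 : Δ ≤ 1) {ε : ℝ} (hε0 : 0 < ε) (hεe : ε ≤ e)
    (he : e ≤ convRadius K S B (coherence Φ) Δ (gammaOne ν S)) (hΨ : ∀ k, ‖Ψ k - Φ k‖ ≤ e)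
    {w : Fin N → Ω → Draw K} (hw : ∀ n, Measurable (w n)) (hlaw : ∀ n, P.map (w n) = drawLaw ν)
    (hind : iIndepFun w P) :
    P {ω | ¬ ∀ k, ‖itksmStep T (fun n => signal Φ (w n ω)) Ψ k - Φ k‖ ≤ 3 / 5 * e} ≤
      ENNReal.ofReal (2 * K * Real.exp (-(gammaOne ν S ^ 2 * N * ε ^ 2) / (200 * S * K))) := by
  have hK : 0 < K := hS.trans hSK
  have hB := one_le_frame_bound hK hΦ hF
  obtain ⟨hγ, hγS⟩ := gammaOne_mem_Icc hSK h
  have hK' : (0 : ℝ) < K := by exact_mod_cast hK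
  have hS' : (0 : ℝ) < S := by linarith
  have he1 : e < 1 := by
    have h1 : 0 ≤ 2 * coherence Φ * S := by
      have := coherence_nonneg Φ
      positivity
    have h2 := mul_sqrt_le_of_le_convRadius hSK hB (by linarith) (by linarith) hγ hγS he
    have h3 : 1 ≤ √B := Real.one_le_sqrt.2 hB
    nlinarith
  have hsub : {ω | ¬ ∀ k, ‖itksmStep T (fun n => signal Φ (w n ω)) Ψ k - Φ k‖ ≤ 3 / 5 * e} ⊆
      ⋃ k, {ω | gammaOne ν S / K * (3 / 10 * e) <
        ‖signalMean T (fun n => signal Φ (w n ω)) Ψ k - (gammaOne ν S / K) • Φ k‖} := by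
    intro ω hω
    simp only [Set.mem_ofPred_eq, not_forall] at hω
    obtain ⟨k, hk⟩ := hω
    refine Set.mem_iUnion.2 ⟨k, ?_⟩
    by_contra hcon
    refine hk ((norm_normalize_sub_le (hΦ k) (by positivity) (by linarith)
      (not_lt.1 hcon)).trans (by linarith))
  refine (measure_mono hsub).trans ((measure_iUnion_fintype_le _ _).trans ?_)
  refine (Finset.sum_le_sum fun k _ => measure_lt_norm_signalMean_sub_le T hS hSK hΦ hF h hΔ hΔ1
    (hε0.trans_le hεe) he hΨ hw hlaw hind k).trans ?_
  rw [Finset.sum_const, Finset.card_univ, Fintype.card_fin, nsmul_eq_mul,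
    ← ENNReal.ofReal_natCast, ← ENNReal.ofReal_mul (by positivity)]
  refine ENNReal.ofReal_le_ofReal ?_
  -- Replacing `e` by the smaller target `ε` makes the failure probability the same for all
  -- iterations.
  have h1 : gammaOne ν S ^ 2 * N * ε ^ 2 / (200 * S * K) ≤
      gammaOne ν S ^ 2 * N * e ^ 2 / (128 * S * K) := by
    gcongr
    norm_num
  calc (K : ℝ) * (2 * Real.exp (-(gammaOne ν S ^ 2 * N * e ^ 2 / (128 * S * K))))
      ≤ K * (2 * Real.exp (-(gammaOne ν S ^ 2 * N * ε ^ 2 / (200 * S * K)))) := by gcongr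
    _ = _ := by rw [neg_div]; ring

end Step

/-! ### Many iterations -/

/-- The families whose atoms are within `e` of the corresponding atoms of `Φ`. -/
def closeTo {d K : ℕ} (Φ : Atoms d K) (e : ℝ) : Set (Atoms d K) := {Ψ | ∀ k, ‖Ψ k - Φ k‖ ≤ e}

/-! ### Atomwise closeness versus the dictionary distance -/

section Distance

variable {d K : ℕ} {Φ Ψ : Atoms d K} {e : ℝ}

theorem measurableSet_closeTo (Φ : Atoms d K) (e : ℝ) : MeasurableSet (closeTo Φ e) := by
  have h : closeTo Φ e = ⋂ k, {Ψ | ‖Ψ k - Φ k‖ ≤ e} := by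
    ext Ψ
    simp [closeTo]
  rw [h]
  exact .iInter fun k => measurableSet_le (by fun_prop) measurable_const

theorem Aligned.mem_closeTo (hal : Aligned Ψ Φ) (h : dictDist Ψ Φ ≤ e) : Ψ ∈ closeTo Φ e :=
  fun k => (le_ciSup (f := fun k => ‖Ψ k - Φ k‖) (Set.finite_range _).bddAbove k).trans
    (hal.symm.trans_le h)

theorem one_le_norm_of_coherence_le {x y : Vec d} (hx : ‖x‖ = 1) (hy : ‖y‖ = 1)
    (h : |⟪x, y⟫| ≤ 1 / 2) : 1 ≤ ‖x - y‖ ∧ 1 ≤ ‖x + y‖ := by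
  have h1 := norm_sub_sq_real x y
  have h2 := norm_add_sq_real x y
  have h3 := abs_le.1 h
  rw [hx, hy] at h1 h2
  constructor
  · nlinarith [norm_nonneg (x - y)]
  · nlinarith [norm_nonneg (x + y)]

/-- Low coherence puts `φ_k` at distance at least `1` from `-φ_k` and from every `±φ_l` with `l ≠
k`. An atom within `1/2` of `φ_k` therefore has `φ_k` as a nearest signed atom, and the inner
minimum is attained there. -/
theorem dictDist_le_and_aligned_of_mem_closeTo (hK : 0 < K) (hΦ : IsDictionary Φ)
    (hμ : coherence Φ ≤ 1 / 2) (he : e ≤ 1 / 2) (h : Ψ ∈ closeTo Φ e) :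
    dictDist Ψ Φ ≤ e ∧ Aligned Ψ Φ := by
  have : Nonempty (Fin K) := ⟨⟨0, hK⟩⟩
  have hsub : ∀ k l, ‖Ψ k - Φ k‖ ≤ ‖Ψ k - Φ l‖ := by
    intro k l
    rcases eq_or_ne k l with rfl | hkl
    · exact le_rfl
    have h1 := (one_le_norm_of_coherence_le (hΦ k) (hΦ l)
      ((abs_inner_le_coherence Φ hkl).trans hμ)).1
    have h2 := norm_sub_le_norm_sub_add_norm_sub (Φ k) (Ψ k) (Φ l)
    rw [norm_sub_rev (Φ k) (Ψ k)] at h2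
    have := h k
    linarith
  have hadd : ∀ k l, ‖Ψ k - Φ k‖ ≤ ‖Ψ k + Φ l‖ := by
    intro k l
    have h1 : 1 ≤ ‖Φ k + Φ l‖ := by
      rcases eq_or_ne k l with rfl | hkl
      · rw [← two_smul ℝ, norm_smul, hΦ]
        norm_num
      · exact (one_le_norm_of_coherence_le (hΦ k) (hΦ l)
          ((abs_inner_le_coherence Φ hkl).trans hμ)).2
    have h2 := norm_sub_le (Ψ k + Φ l) (Ψ k - Φ k)
    rw [show Ψ k + Φ l - (Ψ k - Φ k) = Φ k + Φ l by abel] at h2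
    have := h k
    linarith
  have heq : dictDist Ψ Φ = ⨆ k, ‖Ψ k - Φ k‖ := by
    rw [dictDist]
    congr 1
    ext k
    refine le_antisymm ?_ (le_ciInf fun l => le_min (hsub k l) (hadd k l))
    exact (ciInf_le (Set.finite_range _).bddBelow k).trans (min_le_left _ _)
  exact ⟨heq.trans_le (ciSup_le h), heq⟩

end Distance

theorem indepFun_castSucc_last {Ω α : Type*} [MeasurableSpace Ω] [MeasurableSpace α]
    {P : Measure Ω} {L N : ℕ} {w : Fin (L + 1) × Fin N → Ω → α} (hw : ∀ i, Measurable (w i))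
    (hind : iIndepFun w P) :
    IndepFun (fun ω (i : Fin L × Fin N) => w (i.1.castSucc, i.2) ω)
      (fun ω n => w (Fin.last L, n) ω) P := by
  classical
  let s : Finset (Fin (L + 1) × Fin N) := Finset.univ.filter fun i => i.1 ≠ Fin.last L
  let t : Finset (Fin (L + 1) × Fin N) := Finset.univ.filter fun i => i.1 = Fin.last L
  have hs : ∀ i : Fin L × Fin N, (i.1.castSucc, i.2) ∈ s := fun i => by
    simp [s, Fin.castSucc_ne_last]
  have ht : ∀ n : Fin N, (Fin.last L, n) ∈ t := fun n => by simp [t]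
  have hI := hind.indepFun_finset s t (Finset.disjoint_filter.2 fun i _ h1 h2 => h1 h2) hw
  have hφ : Measurable fun (v : s → α) (i : Fin L × Fin N) => v ⟨_, hs i⟩ :=
    measurable_pi_lambda _ fun i => measurable_pi_apply _
  have hψ : Measurable fun (v : t → α) (n : Fin N) => v ⟨_, ht n⟩ :=
    measurable_pi_lambda _ fun n => measurable_pi_apply _
  exact hI.comp hφ hψ

/-! ### Chaining the iterations over independent batches -/

section Iteration

variable {d K S N : ℕ} {Φ Ψ : Atoms d K} {A B Δ : ℝ} {ν : Measure (Vec K)}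

theorem measurable_itksmStep (T : ThresholdRule d K S) {α : Type*} [MeasurableSpace α]
    {y : α → Fin N → Vec d} {X : α → Atoms d K} (hy : ∀ n, Measurable fun a => y a n)
    (hX : Measurable X) : Measurable fun a => itksmStep T (y a) (X a) := by
  refine measurable_pi_lambda _ fun k => ?_
  have h : Measurable fun a => signalMean T (y a) (X a) k := by
    simp only [signalMean_eq]
    have h1 : ∀ n, Measurable fun a => signalTerm T (X a) k (y a n) := fun n =>
      (measurable_signalTerm T k).comp (hX.prodMk (hy n))
    exact (Finset.measurable_sum Finset.univ fun n _ => h1 n).const_smul (1 / (N : ℝ))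
  exact h.norm.inv.smul h

theorem itksm_succ {L : ℕ} (T : ThresholdRule d K S) (y : Fin (L + 1) → Fin N → Vec d)
    (Ψ : Atoms d K) :
    itksm T y Ψ = itksmStep T (y (Fin.last L)) (itksm T (fun l => y l.castSucc) Ψ) :=
  Fin.foldl_succ_last _ _

theorem measurable_itksm {L : ℕ} (T : ThresholdRule d K S) {α : Type*} [MeasurableSpace α]
    {y : α → Fin L → Fin N → Vec d} (hy : ∀ l n, Measurable fun a => y a l n) (Ψ : Atoms d K) :
    Measurable fun a => itksm T (y a) Ψ := by
  induction L with
  | zero =>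
    simp only [itksm, Fin.foldl_zero]
    exact measurable_const
  | succ L ih =>
    simp only [itksm_succ]
    exact measurable_itksmStep T (hy _) (ih fun l n => hy l.castSucc n)

variable [IsProbabilityMeasure (rearrLaw ν)] {Ω : Type*} [MeasurableSpace Ω] {P : Measure Ω}
  [IsProbabilityMeasure P]

theorem measure_itksm_notMem_closeTo_le (T : ThresholdRule d K S) (hS : 1 ≤ S) (hSK : S ≤ K)
    (hΦ : IsDictionary Φ) (hF : IsFrame Φ A B) (h : ∀ᵐ c ∂(rearrLaw ν), IsSparseSeq S Δ c)
    (hΔ : 2 * coherence Φ * S < Δ) (hΔ1 : Δ ≤ 1) {ε R : ℝ} (hε0 : 0 < ε) (hεR : ε ≤ R)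
    (hR : R ≤ convRadius K S B (coherence Φ) Δ (gammaOne ν S)) (hΨ : Ψ ∈ closeTo Φ R) (L : ℕ)
    (w : Fin L × Fin N → Ω → Draw K) (hw : ∀ i, Measurable (w i))
    (hlaw : ∀ i, P.map (w i) = drawLaw ν) (hind : iIndepFun w P) :
    P {ω | itksm T (fun l n => signal Φ (w (l, n) ω)) Ψ ∉ closeTo Φ (max ((3 / 5) ^ L * R) ε)} ≤
      L * ENNReal.ofReal
        (2 * K * Real.exp (-(gammaOne ν S ^ 2 * N * ε ^ 2) / (200 * S * K))) := by
  induction L with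
  | zero =>
    have : ∀ ω, itksm T (fun (l : Fin 0) n => signal Φ (w (l, n) ω)) Ψ = Ψ := fun ω => by
      simp only [itksm, Fin.foldl_zero]
    simp only [this]
    have h2 : Ψ ∈ closeTo Φ (max R ε) := fun k => (hΨ k).trans (le_max_left _ _)
    simp [h2]
  | succ L ih =>
    set q := ENNReal.ofReal
      (2 * K * Real.exp (-(gammaOne ν S ^ 2 * N * ε ^ 2) / (200 * S * K)))
    set e := max ((3 / 5) ^ L * R) ε with he
    have heR : e ≤ R := by
      refine max_le ?_ hεR
      exact mul_le_of_le_one_left (hε0.le.trans hεR) (pow_le_one₀ (by norm_num) (by norm_num))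
    have hεe : ε ≤ e := le_max_right _ _
    -- Once the radius has reached `ε` it is held there, the further contraction being discarded.
    have he' : 3 / 5 * e ≤ max ((3 / 5) ^ (L + 1) * R) ε := by
      rw [he, mul_max_of_nonneg _ _ (by norm_num : (0 : ℝ) ≤ 3 / 5), pow_succ']
      exact max_le_max (by rw [mul_assoc]) (by linarith)
    let X : Ω → Atoms d K := fun ω =>
      itksm T (fun (l : Fin L) n => signal Φ (w (l.castSucc, n) ω)) Ψ
    let W : Ω → Fin N → Draw K := fun ω n => w (Fin.last L, n) ω
    have hinj : Function.Injective fun i : Fin L × Fin N => (i.1.castSucc, i.2) := by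
      rintro ⟨a, b⟩ ⟨a', b'⟩ hab
      simpa using hab
    have hsig := measurable_signal Φ
    have hXm : Measurable X := measurable_itksm T (fun l n => hsig.comp (hw _)) Ψ
    have hWm : Measurable W := measurable_pi_lambda _ fun n => hw _
    have hXW : IndepFun X W P := by
      have hF : Measurable fun v : Fin L × Fin N → Draw K =>
          itksm T (fun (l : Fin L) n => signal Φ (v (l, n))) Ψ :=
        measurable_itksm T (fun l n => hsig.comp (measurable_pi_apply (l, n))) Ψ
      exact (indepFun_castSucc_last hw hind).comp hF measurable_id
    have hprod := (indepFun_iff_map_prod_eq_prod_map_map hXm.aemeasurable hWm.aemeasurable).1 hXW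
    have hP1 : IsProbabilityMeasure (P.map X) := Measure.isProbabilityMeasure_map hXm.aemeasurable
    have hP2 : IsProbabilityMeasure (P.map W) := Measure.isProbabilityMeasure_map hWm.aemeasurable
    -- Failure of the last step alone. Requiring the input dictionary to be close makes every
    -- section either empty or covered by the one-step estimate, so the product law of dictionary
    -- and fresh batch gives the bound.
    let bad : Set (Atoms d K × (Fin N → Draw K)) := {x | x.1 ∈ closeTo Φ e ∧
      itksmStep T (fun n => signal Φ (x.2 n)) x.1 ∉ closeTo Φ (3 / 5 * e)}
    have hstepm : Measurable fun x : Atoms d K × (Fin N → Draw K) =>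
        itksmStep T (fun n => signal Φ (x.2 n)) x.1 :=
      measurable_itksmStep T
        (fun n => hsig.comp ((measurable_pi_apply n).comp measurable_snd)) measurable_fst
    have hbad : MeasurableSet bad :=
      (measurable_fst (measurableSet_closeTo Φ e)).inter
        (hstepm (measurableSet_closeTo Φ (3 / 5 * e))).compl
    have hbad_le : P {ω | (X ω, W ω) ∈ bad} ≤ q := by
      have h1 : P {ω | (X ω, W ω) ∈ bad} = (P.map X).prod (P.map W) bad := by
        rw [← hprod, Measure.map_apply (hXm.prodMk hWm) hbad]
        rfl
      rw [h1]
      refine prod_apply_le_of_ae_le hbad (.of_forall fun Ψ' => ?_)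
      rw [Measure.map_apply hWm (hbad.preimage measurable_prodMk_left)]
      by_cases hc : Ψ' ∈ closeTo Φ e
      · refine (measure_mono fun ω hω => ?_).trans
          (measure_not_itksmStep_close_le (w := fun n => w (Fin.last L, n)) T hS hSK hΦ hF h hΔ
            hΔ1 hε0 hεe (heR.trans hR) hc (fun n => hw _) (fun n => hlaw _)
            (hind.precomp (g := fun n => (Fin.last L, n)) fun a b hab => by simpa using hab))
        exact hω.2
      · have : W ⁻¹' (Prod.mk Ψ' ⁻¹' bad) = ∅ := by
          ext ω
          simp [bad, hc]
        rw [this]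
        simp
    have hrec := ih (fun i => w (i.1.castSucc, i.2)) (fun i => hw _) (fun i => hlaw _)
      (hind.precomp hinj)
    have hsub : {ω | itksm T (fun l n => signal Φ (w (l, n) ω)) Ψ ∉
        closeTo Φ (max ((3 / 5) ^ (L + 1) * R) ε)} ⊆
        {ω | X ω ∉ closeTo Φ e} ∪ {ω | (X ω, W ω) ∈ bad} := by
      intro ω hω
      by_cases hc : X ω ∈ closeTo Φ e
      · refine Or.inr ⟨hc, fun hcl => hω ?_⟩
        rw [itksm_succ]
        exact fun k => (hcl k).trans he'
      · exact Or.inl hc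
    calc _ ≤ P {ω | X ω ∉ closeTo Φ e} + P {ω | (X ω, W ω) ∈ bad} :=
          (measure_mono hsub).trans (measure_union_le _ _)
      _ ≤ L * q + q := add_le_add hrec hbad_le
      _ = _ := by push_cast; ring

end Iteration

/-! ### The iteration count and the final assembly -/

theorem pow_numIter_le {ε : ℝ} (hε : 0 < ε) : (3 / 5 : ℝ) ^ numIter ε ≤ ε := by
  -- Each block of six contractions gains a factor `exp 1`; this is the `6` in `numIter`.
  have h1 : (3 / 5 : ℝ) ^ 6 ≤ Real.exp (-1) := by
    rw [Real.exp_neg]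
    have h3 : Real.exp 1 ≤ 3 := by linarith [Real.exp_one_lt_d9]
    calc (3 / 5 : ℝ) ^ 6 ≤ 3⁻¹ := by norm_num
      _ ≤ _ := inv_anti₀ (Real.exp_pos 1) h3
  calc (3 / 5 : ℝ) ^ numIter ε ≤ Real.exp (-1) ^ ⌈Real.log ε⁻¹⌉₊ := by
        rw [numIter, pow_mul]
        gcongr
    _ = Real.exp (-(⌈Real.log ε⁻¹⌉₊ : ℝ)) := by
        rw [← Real.exp_nat_mul]
        congr 1
        ring
    _ ≤ Real.exp (-Real.log ε⁻¹) := by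
        gcongr
        exact Nat.le_ceil _
    _ = ε := by rw [Real.log_inv, neg_neg, Real.exp_log hε]

/-- Rounding up costs less than `1`, and `log ε⁻¹ ≥ 2`, so `12 (log ε⁻¹ + 1) ≤ 18 log ε⁻¹`. The `2`
on the left comes from the Bernstein tail. -/
theorem two_mul_numIter_le {ε : ℝ} (hε : 0 < ε) (h : ε ≤ 1 / 20) :
    2 * (numIter ε : ℝ) ≤ 18 * Real.log ε⁻¹ := by
  have h20 : (20 : ℝ) ≤ ε⁻¹ := by
    rw [le_inv_comm₀ (by norm_num) hε]
    linarith
  have h2 : 2 ≤ Real.log ε⁻¹ := by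
    rw [Real.le_log_iff_exp_le (by positivity)]
    have h1 : Real.exp 2 = Real.exp 1 ^ 2 := by rw [← Real.exp_nat_mul]; norm_num
    rw [h1]
    calc Real.exp 1 ^ 2 ≤ 3 ^ 2 := by
          gcongr
          linarith [Real.exp_one_lt_d9]
      _ ≤ ε⁻¹ := by linarith
  have h3 := Nat.ceil_lt_add_one (show 0 ≤ Real.log ε⁻¹ by linarith)
  rw [numIter]
  push_cast
  linarith

theorem corollary2 {d K S N : ℕ} (hS : 1 ≤ S) (hSK : S ≤ K)
    (Φ : Atoms d K) (hΦ : IsDictionary Φ) (A B : ℝ) (hF : IsFrame Φ A B)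
    (ν : Measure (Vec K)) (hν : IsCoeffDist ν) (β Δ : ℝ) (hgap : IsSparse ν S β Δ)
    (hexact : IsExactlySparse ν S) (hΔ : 2 * coherence Φ * S < Δ)
    (ε : ℝ) (hε : 0 < ε) (hεR : ε ≤ convRadius K S B (coherence Φ) Δ (gammaOne ν S))
    (Ψ : Atoms d K) (hΨ : IsDictionary Ψ) (hal : Aligned Ψ Φ)
    (hdist : dictDist Ψ Φ ≤ convRadius K S B (coherence Φ) Δ (gammaOne ν S))
    (T : ThresholdRule d K S)
    {Ω : Type*} [MeasurableSpace Ω] (P : Measure Ω) [IsProbabilityMeasure P]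
    (w : Fin (numIter ε) × Fin N → Ω → Draw K) (hw : ∀ i, Measurable (w i))
    (hlaw : ∀ i, P.map (w i) = drawLaw ν) (hindep : iIndepFun w P) :
    P {ω | ¬ (dictDist (itksm T (fun l n => signal Φ (w (l, n) ω)) Ψ) Φ ≤ ε ∧
        Aligned (itksm T (fun l n => signal Φ (w (l, n) ω)) Ψ) Φ)} ≤
      ENNReal.ofReal (18 * Real.log ε⁻¹ * K *
        Real.exp (-(gammaOne ν S ^ 2 * N * ε ^ 2) / (200 * S * K))) := by
  have hK : 0 < K := hS.trans hSK
  have := isProbabilityMeasure_rearrLaw hν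
  have h := ae_isSparseSeq hS hSK hν hgap hexact
  -- One admissible sequence suffices for the deterministic fact `Δ ≤ 1`, and then `2μ ≤ 2μS < Δ`
  -- yields coherence at most `1/2`.
  obtain ⟨c, hc⟩ := h.exists
  have hΔ1 := hc.gap_le_one hS hSK
  have hB := one_le_frame_bound hK hΦ hF
  obtain ⟨hγ, hγS⟩ := gammaOne_mem_Icc hSK h
  have hμ0 := coherence_nonneg Φ
  have hS' : (1 : ℝ) ≤ S := by exact_mod_cast hS
  have hμ : coherence Φ ≤ 1 / 2 := by nlinarith
  have hr : ∀ r, 0 < r → r ≤ convRadius K S B (coherence Φ) Δ (gammaOne ν S) → r ≤ 1 / 20 := by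
    intro r hr0 hr
    have h1 : 0 ≤ 2 * coherence Φ * S := by positivity
    have h2 := mul_sqrt_le_of_le_convRadius hSK hB (by linarith) (by linarith) hγ hγS hr
    have h3 : 1 ≤ √B := Real.one_le_sqrt.2 hB
    nlinarith
  have hε20 := hr ε hε hεR
  have hR20 := hr _ (hε.trans_le hεR) le_rfl
  have hmain := measure_itksm_notMem_closeTo_le T hS hSK hΦ hF h hΔ hΔ1 hε hεR le_rfl
    (hal.mem_closeTo hdist) (numIter ε) w hw hlaw hindep
  -- The starting radius is at most `1/20`, hence below `1`, so the contraction factor alone brings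
  -- it under `ε`.
  have hmax : max ((3 / 5) ^ numIter ε * convRadius K S B (coherence Φ) Δ (gammaOne ν S)) ε =
      ε := by
    refine max_eq_right ((mul_le_of_le_one_right (by positivity) ?_).trans (pow_numIter_le hε))
    linarith
  rw [hmax] at hmain
  refine (measure_mono ?_).trans (hmain.trans ?_)
  · intro ω hω hcl
    exact hω (dictDist_le_and_aligned_of_mem_closeTo hK hΦ hμ (by linarith) hcl)
  · rw [← ENNReal.ofReal_natCast, ← ENNReal.ofReal_mul (by positivity)]
    refine ENNReal.ofReal_le_ofReal ?_
    have h1 := two_mul_numIter_le hε hε20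
    calc (numIter ε : ℝ) *
          (2 * K * Real.exp (-(gammaOne ν S ^ 2 * N * ε ^ 2) / (200 * S * K)))
        = 2 * (numIter ε : ℝ) *
          (K * Real.exp (-(gammaOne ν S ^ 2 * N * ε ^ 2) / (200 * S * K))) := by ring
      _ ≤ 18 * Real.log ε⁻¹ *
          (K * Real.exp (-(gammaOne ν S ^ 2 * N * ε ^ 2) / (200 * S * K))) := by gcongr
      _ = _ := by ring
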